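/- Let a particle move in $[0,1]$ between two thermal walls with inverse temperatures $\beta_L$ (at $0$) and $\beta_R$ (at $1$). It starts at $q_0\in[0,1]$ with velocity $p_0\neq0$. At each wall it is reflected with a random speed, independent of the past, of law $\phi_\beta(dp)=\beta p\,e^{-\beta p^2/2}\mathbf 1_{\{p>0\}}\,dp$, with $\beta=\beta_L$ at the left wall and $\beta=\beta_R$ at the right wall. Let $\sigma_k=(-1)^k\,\mathrm{sign}(p_0)$, let $S_0=\big(\tfrac{\sigma_0+1}{2}-q_0\big)/p_0$ be the time of the first collision, let $S_k=S_0+\tau_1+\dots+\tau_k$, where $\tau_k$ is the duration of the $k$-th flight between the walls, and let $v_k=\sigma_k/\tau_k$. The energy exchanged during $[0,t]$ is $J[0,t]=\frac12\sum_{k\ge1,\,S_k\le t}\sigma_kv_k^2$. For $\beta_L,\beta_R>0$ and $\lambda\in\mathbb R$ the limit $$f(\lambda,\beta_L,\beta_R)=\lim_{t\to\infty}\frac1t\log\mathbb E\big(e^{\lambda J[0,t]}\big)\in(-\infty,+\infty]$$ exists. Put $$\mathcal F(\lambda,\tau,T)=f\Big(\lambda,\frac1{T+\tau/2},\frac1{T-\tau/2}\Big),\qquad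 \mathcal I(j,\tau,T)=\sup_{\lambda\in\mathbb R}\{\lambda j-\mathcal F(\lambda,\tau,T)\}.$$ Let $T>0$ and $\kappa=\kappa(T)=(T/2\pi)^{1/2}$. 1. If $\tau\ne0$, then for all $\lambda,j\in\mathbb R$ $$\lim_{\varepsilon\downarrow0}\varepsilon^{-2}\mathcal F(\varepsilon\lambda,\varepsilon\tau,T)=\mathcal H(\lambda,\tau,T):=\begin{cases}\lambda\kappa\tau+\kappa\lambda^2T^2&\text{if }\lambda\tau>0,\\ 0&\text{if }\lambda\tau\in[-\tau^2/T^2,0],\\ -\big(\lambda+\frac{\tau}{T^2}\big)\kappa\tau+\kappa\big(\lambda+\frac{\tau}{T^2}\big)^2T^2&\text{if }\lambda\tau<-\tau^2/T^2,\end{cases}$$ $$\lim_{\varepsilon\downarrow0}\varepsilon^{-2}\mathcal I(\varepsilon j,\varepsilon\tau,T)=\mathcal G(j,\tau,T):=\begin{cases}\frac{(j-\kappa\tau)^2}{4\kappa T^2}&\text{if }j\tau>\kappa\tau^2,\\ 0&\text{if }j\tau\in[0,\kappa\tau^2],\\ \frac{-j\tau}{T^2}&\text{if }j\tau\in[-\kappa\tau^2,0],\\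 \frac{(j-\kappa\tau)^2}{4\kappa T^2}&\text{if }j\tau<-\kappa\tau^2.\end{cases}$$ 2. If $\tau=0$, then $\lim_{\varepsilon\downarrow0}\varepsilon^{-2}\mathcal F(\varepsilon\lambda,0,T)=\kappa\lambda^2T^2$ and $\lim_{\varepsilon\downarrow0}\varepsilon^{-2}\mathcal I(\varepsilon j,0,T)=\frac{j^2}{4\kappa T^2}$ for all $\lambda,j\in\mathbb R$. With $\mathcal H(\lambda,0,T):=\kappa\lambda^2T^2$ and $\mathcal G(j,0,T):=\frac{j^2}{4\kappa T^2}$, these convergences are uniform in $(\lambda,\tau,T)$, respectively in $(j,\tau,T)$, on every compact subset of $\mathbb R\times\mathbb R\times(0,\infty)$. -/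

import Mathlib

open MeasureTheory Filter Topology

noncomputable section

namespace ConfinedTracer

/-! ### A particle in `[0, 1]` between two thermal walls -/

/-- The law `φ_β(dp) = β p exp(-β p² / 2) 1_{p > 0} dp` of the speed with which a particle leaves a
wall of inverse temperature `β`. -/
def wallLaw (β : ℝ) : Measure ℝ :=
  (volume.restrict (Set.Ioi (0 : ℝ))).withDensity
    fun p => ENNReal.ofReal (β * p * Real.exp (-(β * p ^ 2 / 2)))

/-- `φ_β` is a probability law. -/
theorem isProbabilityMeasure_wallLaw {β : ℝ} (hβ : 0 < β) :
    IsProbabilityMeasure (wallLaw β) := by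
  constructor
  have hd : ∀ x ∈ Set.Ici (0 : ℝ), HasDerivAt (fun p : ℝ => -Real.exp (-(β * p ^ 2 / 2)))
      (β * x * Real.exp (-(β * x ^ 2 / 2))) x := by
    intro x _
    have h : HasDerivAt (fun p : ℝ => -Real.exp (-(β * p ^ 2 / 2)))
        (-(Real.exp (-(β * x ^ 2 / 2)) * -(β * ((2 : ℕ) * x ^ (2 - 1)) / 2))) x :=
      ((((hasDerivAt_pow 2 x).const_mul β).div_const 2).neg.exp).neg
    refine h.congr_deriv ?_
    push_cast
    ring
  have hlim : Tendsto (fun p : ℝ => -Real.exp (-(β * p ^ 2 / 2))) atTop (𝓝 0) := by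
    rw [← neg_zero]
    refine (Real.tendsto_exp_neg_atTop_nhds_zero.comp ?_).neg
    exact ((tendsto_pow_atTop two_ne_zero).const_mul_atTop hβ).atTop_div_const two_pos
  have hpos : ∀ x ∈ Set.Ioi (0 : ℝ), 0 ≤ β * x * Real.exp (-(β * x ^ 2 / 2)) := by
    intro x hx
    have : (0 : ℝ) < x := hx
    positivity
  have hi := integrableOn_Ioi_deriv_of_nonneg' hd hpos hlim
  have hv := integral_Ioi_of_hasDerivAt_of_nonneg' hd hpos hlim
  rw [wallLaw, withDensity_apply _ MeasurableSet.univ, Measure.restrict_univ,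
    ← ofReal_integral_eq_lintegral_ofReal hi
      ((ae_restrict_iff' measurableSet_Ioi).2 (Eventually.of_forall hpos)), hv]
  simp

/-- The signs `σ_k = (-1)^k σ_0`, where `σ_0 = sign p₀`. -/
def flightSign (p₀ : ℝ) (k : ℕ) : ℝ := (-1) ^ k * Real.sign p₀

/-- `β_{-1} = β_L` (left wall) and `β_{1} = β_R` (right wall). -/
def wallBeta (βL βR σ : ℝ) : ℝ := if 0 < σ then βR else βL

/-- The joint law of the speeds of the successive flights between the walls. The coordinate `k`
is the speed `1 / τ_{k+1}` of flight number `k + 1`; the coordinates are independent and `1 / τ_{k+1}`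
has law `φ_β` with `β = β_{σ_k}`. -/
def speedLaw (βL βR p₀ : ℝ) : Measure (ℕ → ℝ) :=
  Measure.infinitePi fun k => wallLaw (wallBeta βL βR (flightSign p₀ k))

/-- The duration `τ_{k+1}` of flight number `k + 1`. -/
def flightTime (ω : ℕ → ℝ) (k : ℕ) : ℝ := 1 / ω k

/-- The time `S_k = S_0 + τ_1 + ⋯ + τ_k` of the collision number `k + 1` with the walls, where
`S_0 = (σ̂_0 - q₀) / p₀` and `σ̂_0 = (σ_0 + 1) / 2` is the wall towards which the particle starts. -/
def collisionTime (q₀ p₀ : ℝ) (ω : ℕ → ℝ) (k : ℕ) : ℝ :=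
  ((Real.sign p₀ + 1) / 2 - q₀) / p₀ + ∑ i ∈ Finset.range k, flightTime ω i

/-- The velocity `v_{k+1} = σ_{k+1} / τ_{k+1}` during flight number `k + 1`. -/
def flightVelocity (p₀ : ℝ) (ω : ℕ → ℝ) (k : ℕ) : ℝ :=
  flightSign p₀ (k + 1) / flightTime ω k

/-- The energy `J[0,t] = (1/2) ∑_{k ≥ 1, S_k ≤ t} v_k² σ_k` exchanged between the walls during
`[0, t]` (almost surely a finite sum). -/
def energyCurrent (q₀ p₀ : ℝ) (ω : ℕ → ℝ) (t : ℝ) : ℝ :=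
  (1 / 2) * ∑' k : ℕ, if collisionTime q₀ p₀ ω (k + 1) ≤ t then
    flightVelocity p₀ ω k ^ 2 * flightSign p₀ (k + 1) else 0

/-- `(1/t) log E (exp (l J[0,t]))`, with value `+∞` where the expectation is infinite. -/
def scaledCumulant (q₀ p₀ βL βR l t : ℝ) : EReal :=
  ((1 / t : ℝ) : EReal) *
    ENNReal.log (∫⁻ ω, ENNReal.ofReal (Real.exp (l * energyCurrent q₀ p₀ ω t))
      ∂(speedLaw βL βR p₀))

/-- The cumulant generating function
`f(l, β_L, β_R) = lim_{t → ∞} (1/t) log E (exp (l J[0,t]))` (written as an upper limit; that it is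
a limit is part of the theorem). -/
def cumulantGF (q₀ p₀ l βL βR : ℝ) : EReal :=
  limsup (fun t : ℝ => scaledCumulant q₀ p₀ βL βR l t) atTop

/-! ### The scaling limit -/

/-- `𝓕(l, τ, T) = f(l, 1 / (T + τ/2), 1 / (T - τ/2))`. -/
def calF (q₀ p₀ l τ T : ℝ) : EReal :=
  cumulantGF q₀ p₀ l (1 / (T + τ / 2)) (1 / (T - τ / 2))

/-- The Legendre transform `𝓘(j, τ, T) = sup_l (l j - 𝓕(l, τ, T))`. -/
def calI (q₀ p₀ j τ T : ℝ) : EReal :=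
  ⨆ l : ℝ, (((l * j : ℝ) : EReal) - calF q₀ p₀ l τ T)

/-- `κ = (T / 2π)^{1/2}`. -/
def kappa (T : ℝ) : ℝ := Real.sqrt (T / (2 * Real.pi))

/-- The limit `𝓗(l, τ, T)` of the cumulant generating function. -/
def calH (l τ T : ℝ) : ℝ :=
  if τ = 0 then kappa T * l ^ 2 * T ^ 2
  else if 0 < l * τ then l * kappa T * τ + kappa T * l ^ 2 * T ^ 2
  else if -(τ ^ 2 / T ^ 2) ≤ l * τ then 0
  else -(l + τ / T ^ 2) * kappa T * τ + kappa T * (l + τ / T ^ 2) ^ 2 * T ^ 2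

/-- The limit `𝓖(j, τ, T)` of the Legendre transform. -/
def calG (j τ T : ℝ) : ℝ :=
  if τ = 0 then j ^ 2 / (4 * kappa T * T ^ 2)
  else if kappa T * τ ^ 2 < j * τ then (j - kappa T * τ) ^ 2 / (4 * kappa T * T ^ 2)
  else if 0 ≤ j * τ then 0
  else if -(kappa T * τ ^ 2) ≤ j * τ then -(j * τ) / T ^ 2
  else (j - kappa T * τ) ^ 2 / (4 * kappa T * T ^ 2)

end ConfinedTracer

end

/-! Each completed flight multiplies `exp (λ J)` by `exp (±λ ω_k² / 2)`, so the expectation solves a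
renewal equation with a two-periodic kernel (`pathMass_eq`). Its growth rate is decided by
`cycleMass`, the mass of one left-right cycle tilted by `exp (-s * duration)`. If this mass is below
1, an exponential Chernoff bound leaves a convergent geometric series, and the rate is at most `s`
(`pathMass_le`). If it exceeds 1, the renewal inequality propagates a lower bound `c * exp (s t)`
through time (`exists_mul_exp_le_pathMass`). The rate is never negative: a wall emits a speed of
order `1 / t` with probability of order `t⁻²`, so exchanging no energy has only a polynomial cost
(`exists_mul_exp_le_wallLaw`). Hence the rate is the infimum of the `s ≥ 0` with cycle mass below 1
(`exists_growthRate`), unless `λ ≥ β_L` or `-λ ≥ β_R`, where it is `+∞`.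

The tilt replaces `β_L, β_R` by `γ_L = β_L - λ`, `γ_R = β_R + λ`. The cycle mass is `β_L β_R / (γ_L
γ_R)` times two Laplace transforms, each equal to `1 - √(π/2) √γ s + O(s^(3/2))`. After scaling by
`ε`, the ratio `γ_L γ_R / (β_L β_R)` is `1 - ε² q` with `q → λ τ + λ² T²`, and the total first-order
coefficient tends to `1 / κ`. So the rate is asymptotically `ε² κ max(0, λ τ + λ² T²)`, which is
`calH` (`calH_eq`); its plateau comes from the slow flights. All bounds are jointly continuous at `ε
= 0`, so compactness makes the convergence uniform (`eventually_calF_near`).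

For the Legendre transform, `calG` is the transform of `calH` and is attained at a locally bounded
`λ` (`mul_sub_calH_le`, `exists_mul_sub_calH_eq`). Far out, `calF` dominates the linear term
(`exists_linear_lower_bound`), so only a compact range of `λ` matters. -/

noncomputable section

namespace ConfinedTracer

/-! ### Infinite products and the first coordinate -/

section Product

variable {X : Type*}

/-- Prepend a first coordinate to a sequence. -/
def seqCons (p : X × (ℕ → X)) : ℕ → X := fun k => Nat.casesOn k p.1 p.2

@[simp] theorem seqCons_zero (p : X × (ℕ → X)) : seqCons p 0 = p.1 := rfl

@[simp] theorem seqCons_succ (p : X × (ℕ → X)) (k : ℕ) : seqCons p (k + 1) = p.2 k := rfl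

variable [MeasurableSpace X]

theorem measurable_seqCons : Measurable (seqCons : X × (ℕ → X) → ℕ → X) := by
  refine measurable_pi_lambda _ fun k => ?_
  cases k with
  | zero => exact measurable_fst
  | succ k => exact (measurable_pi_apply k).comp measurable_snd

variable (μ : ℕ → Measure X) [∀ k, IsProbabilityMeasure (μ k)]

/-- Tested on finite boxes: enlarging the index set to an initial segment, with full factors at the
new indices, lets coordinate 0 split off. -/
theorem map_seqCons_prod_infinitePi :
    ((μ 0).prod (Measure.infinitePi fun k => μ (k + 1))).map seqCons = Measure.infinitePi μ := by
  classical
  refine Measure.eq_infinitePi μ fun s t ht => ?_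
  have hms : MeasurableSet (Set.pi (s : Set ℕ) t) :=
    MeasurableSet.pi s.countable_toSet fun i _ => ht i
  let u : ℕ → Set X := fun i => if i ∈ s then t i else Set.univ
  have hu : ∀ i, MeasurableSet (u i) := fun i => by
    dsimp only [u]; split_ifs; exacts [ht i, MeasurableSet.univ]
  obtain ⟨n, hn⟩ : ∃ n, s ⊆ Finset.range (n + 1) :=
    ⟨s.sup id, fun i hi => Finset.mem_range.2 (Nat.lt_succ_of_le (Finset.le_sup (f := id) hi))⟩
  have hset : seqCons ⁻¹' Set.pi (s : Set ℕ) t =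
      u 0 ×ˢ Set.pi (Finset.range n : Set ℕ) fun k => u (k + 1) := by
    ext ⟨x, ω⟩
    simp only [Set.mem_preimage, Set.mem_pi, Set.mem_prod, Finset.mem_coe, u]
    constructor
    · intro h
      refine ⟨?_, fun i _ => ?_⟩
      · split_ifs with h0
        exacts [h 0 h0, Set.mem_univ _]
      · split_ifs with h0
        exacts [h (i + 1) h0, Set.mem_univ _]
    · rintro ⟨h0, h1⟩ i hi
      cases i with
      | zero => simpa [hi] using h0
      | succ i =>
        have := h1 i (by have := hn hi; simp at this ⊢; omega)
        simpa [hi] using this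
  rw [Measure.map_apply measurable_seqCons hms, hset, Measure.prod_prod,
    Measure.infinitePi_pi _ fun i _ => hu (i + 1)]
  have : ∏ i ∈ s, μ i (t i) = ∏ i ∈ Finset.range (n + 1), μ i (u i) := by
    rw [← Finset.prod_subset hn]
    · exact Finset.prod_congr rfl fun i hi => by simp [u, hi]
    · intro i _ hi
      simp [u, hi]
  rw [this, Finset.prod_range_succ']
  exact mul_comm _ _

theorem lintegral_infinitePi_eq {f : (ℕ → X) → ENNReal} (hf : Measurable f) :
    ∫⁻ ω, f ω ∂Measure.infinitePi μ =
      ∫⁻ x, ∫⁻ ω, f (seqCons (x, ω)) ∂(Measure.infinitePi fun k => μ (k + 1)) ∂μ 0 := by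
  rw [← map_seqCons_prod_infinitePi, lintegral_map hf measurable_seqCons,
    lintegral_prod (fun p => f (seqCons p)) (hf.comp measurable_seqCons).aemeasurable]

theorem lintegral_infinitePi_prod_range (n : ℕ) {g : ℕ → X → ENNReal} (hg : ∀ k, Measurable (g k)) :
    ∫⁻ ω, ∏ k ∈ Finset.range n, g k (ω k) ∂Measure.infinitePi μ =
      ∏ k ∈ Finset.range n, ∫⁻ x, g k x ∂μ k := by
  induction n generalizing μ g with
  | zero => simp
  | succ n ih =>
    have hm : Measurable fun ω : ℕ → X => ∏ k ∈ Finset.range (n + 1), g k (ω k) :=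
      Finset.measurable_fun_prod _ fun k _ => (hg k).comp (measurable_pi_apply k)
    rw [lintegral_infinitePi_eq μ hm]
    simp only [Finset.prod_range_succ', seqCons_zero, seqCons_succ]
    have hm' : Measurable fun ω : ℕ → X => ∏ k ∈ Finset.range n, g (k + 1) (ω k) :=
      Finset.measurable_fun_prod _ fun k _ => (hg (k + 1)).comp (measurable_pi_apply k)
    simp_rw [lintegral_mul_const _ hm', ih (fun k => μ (k + 1)) fun k => hg (k + 1)]
    rw [lintegral_const_mul _ (hg 0)]

end Product

/-! ### Path weights and the renewal equation -/

/-- The time elapsed between the first collision and collision number `n + 1`. -/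
def elapsed (ω : ℕ → ℝ) (n : ℕ) : ℝ := ∑ i ∈ Finset.range n, flightTime ω i

theorem measurable_elapsed (n : ℕ) : Measurable fun ω : ℕ → ℝ => elapsed ω n := by
  unfold elapsed flightTime
  fun_prop

theorem elapsed_seqCons (x : ℝ) (ω : ℕ → ℝ) (n : ℕ) :
    elapsed (seqCons (x, ω)) (n + 1) = elapsed ω n + 1 / x := by
  simp [elapsed, flightTime, Finset.sum_range_succ']

/-- The weight `exp (∑ θ_k ω_k² / 2)`, where the sum runs over the flights that are completed at
time `t`, as a sum over the number of these flights. -/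
def pathWeight (θ : ℕ → ℝ) (t : ℝ) (ω : ℕ → ℝ) : ENNReal :=
  ∑' n : ℕ, if elapsed ω n ≤ t ∧ t < elapsed ω (n + 1) then
    ENNReal.ofReal (Real.exp (∑ k ∈ Finset.range n, θ k * ω k ^ 2 / 2)) else 0

theorem measurable_pathWeight (θ : ℕ → ℝ) :
    Measurable fun p : ℝ × (ℕ → ℝ) => pathWeight θ p.1 p.2 := by
  refine Measurable.tsum fun n => Measurable.ite ?_ ?_ measurable_const
  · exact (measurableSet_le ((measurable_elapsed n).comp measurable_snd) measurable_fst).inter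
      (measurableSet_lt measurable_fst ((measurable_elapsed (n + 1)).comp measurable_snd))
  · fun_prop

/-- Renewal decomposition: either the first flight is still under way at time `t`, or it took `1 /
x` and the weight restarts with shifted parameters. -/
theorem pathWeight_seqCons (θ : ℕ → ℝ) (t x : ℝ) (ω : ℕ → ℝ) :
    pathWeight θ t (seqCons (x, ω)) = (if 0 ≤ t ∧ t < 1 / x then 1 else 0) +
      ENNReal.ofReal (Real.exp (θ 0 * x ^ 2 / 2)) *
        pathWeight (fun k => θ (k + 1)) (t - 1 / x) ω := by
  rw [pathWeight, tsum_eq_zero_add' ENNReal.summable, pathWeight, ← ENNReal.tsum_mul_left]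
  congr 1
  · simp [elapsed, flightTime]
  · refine tsum_congr fun n => ?_
    have h : (elapsed (seqCons (x, ω)) (n + 1) ≤ t ∧ t < elapsed (seqCons (x, ω)) (n + 1 + 1)) ↔
        (elapsed ω n ≤ t - 1 / x ∧ t - 1 / x < elapsed ω (n + 1)) := by
      rw [elapsed_seqCons, elapsed_seqCons, le_sub_iff_add_le, sub_lt_iff_lt_add]
    simp only [h, mul_ite, mul_zero]
    congr 1
    rw [← ENNReal.ofReal_mul (Real.exp_pos _).le, ← Real.exp_add, Finset.sum_range_succ', add_comm]
    simp

/-- The expectation of the path weight when the speed number `k` has law `wallLaw (b k)`. -/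
def pathMass (b θ : ℕ → ℝ) (t : ℝ) : ENNReal :=
  ∫⁻ ω, pathWeight θ t ω ∂Measure.infinitePi fun k => wallLaw (b k)

/-- The mass `E exp (θ p² / 2 - s / p)` under the law `wallLaw β`. -/
def tiltMass (β θ s : ℝ) : ENNReal :=
  ∫⁻ x, ENNReal.ofReal (Real.exp (θ * x ^ 2 / 2 - s / x)) ∂wallLaw β

theorem pathMass_eq {b : ℕ → ℝ} (hb : ∀ k, 0 < b k) (θ : ℕ → ℝ) (t : ℝ) :
    pathMass b θ t = ∫⁻ x, ((if 0 ≤ t ∧ t < 1 / x then 1 else 0) +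
      ENNReal.ofReal (Real.exp (θ 0 * x ^ 2 / 2)) *
        pathMass (fun k => b (k + 1)) (fun k => θ (k + 1)) (t - 1 / x)) ∂wallLaw (b 0) := by
  have := fun k => isProbabilityMeasure_wallLaw (hb k)
  have hm : ∀ (θ : ℕ → ℝ) (t : ℝ), Measurable fun ω : ℕ → ℝ => pathWeight θ t ω := fun θ t =>
    (measurable_pathWeight θ).comp (measurable_const.prodMk measurable_id)
  rw [pathMass, lintegral_infinitePi_eq _ (hm θ t)]
  refine lintegral_congr fun x => ?_
  simp_rw [pathWeight_seqCons]
  rw [lintegral_add_left measurable_const, lintegral_const_mul _ (hm _ _), lintegral_const]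
  simp [pathMass]

/-- A first speed below `1 / A` keeps the first flight unfinished at time `t`, and such paths have
weight 1. -/
theorem wallLaw_le_pathMass {b : ℕ → ℝ} (hb : ∀ k, 0 < b k) (θ : ℕ → ℝ) {t A : ℝ} (ht : 0 ≤ t)
    (hA : t < A) : wallLaw (b 0) (Set.Ioo 0 (1 / A)) ≤ pathMass b θ t := by
  rw [pathMass_eq hb, ← lintegral_indicator_one measurableSet_Ioo]
  refine lintegral_mono fun x => ?_
  by_cases hx : x ∈ Set.Ioo 0 (1 / A)
  · have hx1 : t < 1 / x := hA.trans <| by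
      rw [lt_div_iff₀ hx.1, mul_comm]
      exact (lt_div_iff₀ (ht.trans_lt hA)).1 hx.2
    rw [if_pos ⟨ht, hx1⟩, Set.indicator_of_mem hx]
    exact le_self_add
  · rw [Set.indicator_of_notMem hx]
    exact zero_le

/-- Chernoff bound: when `n` flights are completed by time `t`, `exp (s * (t - elapsed ω n)) ≥ 1`,
and dropping the time constraint leaves a product over the flights. -/
theorem pathWeight_le (θ : ℕ → ℝ) (t : ℝ) {s : ℝ} (hs : 0 ≤ s) (ω : ℕ → ℝ) :
    pathWeight θ t ω ≤ ENNReal.ofReal (Real.exp (s * t)) * ∑' n : ℕ,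
      ∏ k ∈ Finset.range n, ENNReal.ofReal (Real.exp (θ k * ω k ^ 2 / 2 - s / ω k)) := by
  rw [← ENNReal.tsum_mul_left]
  refine ENNReal.tsum_le_tsum fun n => ?_
  split_ifs with h
  · rw [← ENNReal.ofReal_prod_of_nonneg fun _ _ => (Real.exp_pos _).le, ← Real.exp_sum,
      ← ENNReal.ofReal_mul (Real.exp_pos _).le, ← Real.exp_add]
    refine ENNReal.ofReal_le_ofReal (Real.exp_le_exp.2 ?_)
    have := mul_le_mul_of_nonneg_left h.1 hs
    rw [elapsed, Finset.mul_sum] at this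
    have h2 : ∑ i ∈ Finset.range n, s * flightTime ω i = ∑ i ∈ Finset.range n, s / ω i :=
      Finset.sum_congr rfl fun i _ => by rw [flightTime, mul_one_div]
    rw [Finset.sum_sub_distrib]
    linarith
  · exact zero_le

theorem measurable_tilt (θ s : ℝ) :
    Measurable fun x : ℝ => ENNReal.ofReal (Real.exp (θ * x ^ 2 / 2 - s / x)) := by
  fun_prop

theorem pathMass_le {b : ℕ → ℝ} (hb : ∀ k, 0 < b k) (θ : ℕ → ℝ) (t : ℝ) {s : ℝ} (hs : 0 ≤ s) :
    pathMass b θ t ≤ ENNReal.ofReal (Real.exp (s * t)) *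
      ∑' n : ℕ, ∏ k ∈ Finset.range n, tiltMass (b k) (θ k) s := by
  have := fun k => isProbabilityMeasure_wallLaw (hb k)
  have hm : ∀ n, Measurable fun ω : ℕ → ℝ => ∏ k ∈ Finset.range n,
      ENNReal.ofReal (Real.exp (θ k * ω k ^ 2 / 2 - s / ω k)) := fun n =>
    Finset.measurable_fun_prod _ fun k _ => (measurable_tilt _ _).comp (measurable_pi_apply k)
  refine (lintegral_mono fun ω => pathWeight_le θ t hs ω).trans_eq ?_
  rw [lintegral_const_mul _ (Measurable.tsum hm), lintegral_tsum fun n => (hm n).aemeasurable]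
  congr 1
  refine tsum_congr fun n => ?_
  exact lintegral_infinitePi_prod_range _ n fun k => measurable_tilt _ _

/-- For a two-periodic sequence of factors, the sum of the partial products is geometric. -/
theorem tsum_prod_range_ne_top {m : ℕ → ENNReal} (hm : ∀ k, m (k + 2) = m k) (h0 : m 0 ≠ ⊤)
    (h1 : m 0 * m 1 < 1) : ∑' n : ℕ, ∏ k ∈ Finset.range n, m k ≠ ⊤ := by
  have key : ∀ n, ∏ k ∈ Finset.range (n + 2), m k = m 0 * m 1 * ∏ k ∈ Finset.range n, m k := by
    intro n
    rw [Finset.prod_range_succ', Finset.prod_range_succ']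
    simp only [hm]
    ring
  have heven : ∀ n, ∏ k ∈ Finset.range (2 * n), m k = (m 0 * m 1) ^ n := by
    intro n
    induction n with
    | zero => simp
    | succ n ih => rw [mul_add, mul_one, key, ih, pow_succ']
  have hodd : ∀ n, ∏ k ∈ Finset.range (2 * n + 1), m k = m 0 * (m 0 * m 1) ^ n := by
    intro n
    induction n with
    | zero => simp
    | succ n ih =>
      rw [show 2 * (n + 1) + 1 = (2 * n + 1) + 2 by ring, key, ih, pow_succ']
      ring
  have hg : ∑' n : ℕ, (m 0 * m 1) ^ n ≠ ⊤ := by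
    rw [ENNReal.tsum_geometric, ENNReal.inv_ne_top]
    exact (tsub_pos_of_lt h1).ne'
  rw [← tsum_even_add_odd (f := fun n => ∏ k ∈ Finset.range n, m k)
    ENNReal.summable ENNReal.summable]
  simp only [heven, hodd, ENNReal.tsum_mul_left]
  exact ENNReal.add_ne_top.2 ⟨hg, ENNReal.mul_ne_top h0 hg⟩

/-! ### The path weight as exponential of the energy current -/

theorem flightSign_sq {p₀ : ℝ} (hp₀ : p₀ ≠ 0) (k : ℕ) : flightSign p₀ k ^ 2 = 1 := by
  have h : Real.sign p₀ ^ 2 = 1 := by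
    rcases Real.sign_apply_eq_of_ne_zero p₀ hp₀ with h | h <;> rw [h] <;> norm_num
  rw [flightSign, mul_pow, h, mul_one, ← pow_mul, mul_comm, pow_mul]
  simp

/-- The time of the first collision. -/
def firstCollision (q₀ p₀ : ℝ) : ℝ := ((Real.sign p₀ + 1) / 2 - q₀) / p₀

theorem ofReal_exp_energyCurrent (q₀ l : ℝ) {p₀ : ℝ} (hp₀ : p₀ ≠ 0) {t : ℝ}
    (ht : firstCollision q₀ p₀ ≤ t) {ω : ℕ → ℝ} (hω : ∀ k, 0 < ω k)
    (hω' : Tendsto (elapsed ω) atTop atTop) :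
    ENNReal.ofReal (Real.exp (l * energyCurrent q₀ p₀ ω t)) =
      pathWeight (fun k => l * flightSign p₀ (k + 1)) (t - firstCollision q₀ p₀) ω := by
  have hmono : StrictMono (elapsed ω) := strictMono_nat_of_lt_succ fun n => by
    rw [elapsed, elapsed, Finset.sum_range_succ, flightTime]
    exact lt_add_of_pos_right _ (one_div_pos.2 (hω n))
  have hex : ∃ n, t - firstCollision q₀ p₀ < elapsed ω (n + 1) :=
    (((tendsto_add_atTop_iff_nat 1).2 hω').eventually_gt_atTop _).exists
  classical
  set N := Nat.find hex with hN
  have hlt : t - firstCollision q₀ p₀ < elapsed ω (N + 1) := Nat.find_spec hex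
  have hle : elapsed ω N ≤ t - firstCollision q₀ p₀ := by
    rcases Nat.eq_zero_or_pos N with h0 | h0
    · rw [h0]; simpa [elapsed] using ht
    · have := Nat.find_min hex (m := N - 1) (by omega)
      rw [Nat.sub_add_cancel h0] at this
      exact not_lt.1 this
  have hiff : ∀ k, elapsed ω k ≤ t - firstCollision q₀ p₀ ↔ k ≤ N := fun k =>
    ⟨fun h => Nat.lt_succ_iff.1 (hmono.lt_iff_lt.1 (h.trans_lt hlt)),
      fun h => (hmono.monotone h).trans hle⟩
  have hcol : ∀ k, collisionTime q₀ p₀ ω k ≤ t ↔ k ≤ N := fun k => by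
    rw [← hiff, le_sub_iff_add_le']; rfl
  have hJ : energyCurrent q₀ p₀ ω t =
      1 / 2 * ∑ k ∈ Finset.range N, flightVelocity p₀ ω k ^ 2 * flightSign p₀ (k + 1) := by
    rw [energyCurrent, tsum_eq_sum (s := Finset.range N)]
    · congr 1
      refine Finset.sum_congr rfl fun k hk => ?_
      rw [if_pos ((hcol _).2 (Finset.mem_range.1 hk))]
    · intro k hk
      rw [if_neg fun h => hk (Finset.mem_range.2 ((hcol _).1 h))]
  rw [pathWeight, tsum_eq_single N, if_pos ⟨hle, hlt⟩, hJ, Finset.mul_sum, Finset.mul_sum]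
  · congr 2
    refine Finset.sum_congr rfl fun k _ => ?_
    rw [flightVelocity, flightTime, div_pow, flightSign_sq hp₀, div_pow, one_pow,
      one_div_one_div]
    ring
  · intro n hn
    refine if_neg fun h => hn (le_antisymm ((hiff n).1 h.1) ?_)
    by_contra hnN
    exact not_le.2 h.2 ((hiff _).2 (by omega))

/-! ### The tilted mass -/

theorem ae_pos_wallLaw (β : ℝ) : ∀ᵐ x ∂wallLaw β, 0 < x :=
  (withDensity_absolutelyContinuous _ _).ae_le
    ((ae_restrict_iff' measurableSet_Ioi).2 (Eventually.of_forall fun _ hx => hx))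

theorem lintegral_wallLaw (β : ℝ) {g : ℝ → ENNReal} (hg : Measurable g) :
    ∫⁻ x, g x ∂wallLaw β =
      ∫⁻ x in Set.Ioi 0, ENNReal.ofReal (β * x * Real.exp (-(β * x ^ 2 / 2))) * g x := by
  rw [wallLaw, lintegral_withDensity_eq_lintegral_mul _ (by fun_prop) hg]
  rfl

theorem wallLaw_Ioo_pos {β : ℝ} (hβ : 0 < β) {a b : ℝ} (ha : 0 ≤ a) (hab : a < b) :
    0 < wallLaw β (Set.Ioo a b) := by
  rw [← setLIntegral_one, ← lintegral_indicator measurableSet_Ioo,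
    lintegral_wallLaw β (measurable_const.indicator measurableSet_Ioo),
    pos_iff_ne_zero, Ne, lintegral_eq_zero_iff (by fun_prop (disch := measurability)),
    EventuallyEq, ae_restrict_iff' measurableSet_Ioi]
  intro h
  have hsub : Set.Ioo a b ⊆ {x : ℝ | ¬ (x ∈ Set.Ioi (0 : ℝ) →
      ENNReal.ofReal (β * x * Real.exp (-(β * x ^ 2 / 2))) *
        (Set.Ioo a b).indicator (fun _ => (1 : ENNReal)) x = (0 : ℝ → ENNReal) x)} := by
    intro x hx hx'
    have hx0 : 0 < x := ha.trans_lt hx.1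
    have := hx' hx0
    rw [Set.indicator_of_mem hx, mul_one, Pi.zero_apply, ENNReal.ofReal_eq_zero] at this
    exact absurd this (not_le.2 (by positivity))
  have h0 := measure_mono_null hsub (ae_iff.1 h)
  rw [Real.volume_Ioo, ENNReal.ofReal_eq_zero] at h0
  linarith

/-- The integral of `γ p exp (-γ p² / 2 - s / p)` over the positive half-line. -/
def gaussLaplace (γ s : ℝ) : ℝ :=
  ∫ x in Set.Ioi (0 : ℝ), γ * x * Real.exp (-(γ * x ^ 2 / 2)) * Real.exp (-(s / x))

theorem integrableOn_rpow_wall {γ : ℝ} (hγ : 0 < γ) {r : ℝ} (hr : -1 < r) :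
    IntegrableOn (fun x : ℝ => x ^ r * Real.exp (-(γ * x ^ 2 / 2))) (Set.Ioi 0) := by
  refine (integrableOn_rpow_mul_exp_neg_mul_sq (half_pos hγ) hr).congr_fun (fun x _ => ?_)
    measurableSet_Ioi
  dsimp only
  congr 2
  ring

theorem integral_rpow_wall {γ : ℝ} (hγ : 0 < γ) {r : ℝ} (hr : -1 < r) :
    ∫ x in Set.Ioi (0 : ℝ), x ^ r * Real.exp (-(γ * x ^ 2 / 2)) =
      (γ / 2) ^ (-(r + 1) / 2) * (1 / 2) * Real.Gamma ((r + 1) / 2) := by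
  rw [← integral_rpow_mul_exp_neg_mul_rpow two_pos hr (half_pos hγ)]
  refine setIntegral_congr_fun measurableSet_Ioi fun x _ => ?_
  rw [Real.rpow_two]
  congr 2
  ring

theorem integrableOn_gaussLaplace {γ s : ℝ} (hγ : 0 < γ) (hs : 0 ≤ s) :
    IntegrableOn (fun x : ℝ => γ * x * Real.exp (-(γ * x ^ 2 / 2)) * Real.exp (-(s / x)))
      (Set.Ioi 0) := by
  have h1 := (integrableOn_rpow_wall hγ (r := 1) (by norm_num)).const_mul γ
  refine h1.mono' (by fun_prop) ?_
  rw [ae_restrict_iff' measurableSet_Ioi]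
  refine Eventually.of_forall fun x hx => ?_
  have hx0 : 0 < x := hx
  rw [Real.rpow_one, Real.norm_of_nonneg (by positivity), ← mul_assoc]
  exact mul_le_of_le_one_right (by positivity) (Real.exp_le_one_iff.2 (by
    rw [neg_nonpos]; positivity))

theorem gaussLaplace_pos {γ s : ℝ} (hγ : 0 < γ) (hs : 0 ≤ s) : 0 < gaussLaplace γ s := by
  rw [gaussLaplace, setIntegral_pos_iff_support_of_nonneg_ae _ (integrableOn_gaussLaplace hγ hs)]
  · have : Set.Ioi (0 : ℝ) ⊆ (Function.support fun x : ℝ =>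
        γ * x * Real.exp (-(γ * x ^ 2 / 2)) * Real.exp (-(s / x))) ∩ Set.Ioi 0 := by
      intro x hx
      have hx0 : 0 < x := hx
      exact ⟨(by positivity : (0 : ℝ) < _).ne', hx⟩
    exact lt_of_lt_of_le (by simp) (measure_mono this)
  · rw [EventuallyLE, ae_restrict_iff' measurableSet_Ioi]
    refine Eventually.of_forall fun x hx => ?_
    have hx0 : 0 < x := hx
    rw [Pi.zero_apply]
    positivity

theorem gaussLaplace_zero {γ : ℝ} (hγ : 0 < γ) : gaussLaplace γ 0 = 1 := by
  have h := integral_rpow_wall hγ (r := 1) (by norm_num)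
  have h2 : gaussLaplace γ 0 =
      γ * ∫ x in Set.Ioi (0 : ℝ), x ^ (1 : ℝ) * Real.exp (-(γ * x ^ 2 / 2)) := by
    rw [gaussLaplace, ← integral_const_mul]
    refine setIntegral_congr_fun measurableSet_Ioi fun x _ => ?_
    simp [mul_assoc]
  rw [h2, h]
  norm_num
  rw [Real.rpow_neg_one]
  field_simp

/-- The energy weight is absorbed by the density: `β` becomes `β - θ`, up to the normalisation `β /
(β - θ)`. -/
theorem tiltMass_eq {β θ s : ℝ} (hβ : 0 < β) (hθ : θ < β) (hs : 0 ≤ s) :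
    tiltMass β θ s = ENNReal.ofReal (β / (β - θ) * gaussLaplace (β - θ) s) := by
  have hγ : 0 < β - θ := sub_pos.2 hθ
  rw [tiltMass, lintegral_wallLaw β (measurable_tilt θ s), gaussLaplace, ← integral_const_mul,
    ofReal_integral_eq_lintegral_ofReal ((integrableOn_gaussLaplace hγ hs).const_mul _)]
  · refine setLIntegral_congr_fun measurableSet_Ioi fun x hx => ?_
    have hx0 : 0 < x := hx
    rw [← ENNReal.ofReal_mul (by positivity)]
    congr 1
    have : β / (β - θ) * ((β - θ) * x * Real.exp (-((β - θ) * x ^ 2 / 2)) * Real.exp (-(s / x))) =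
        β * x * (Real.exp (-((β - θ) * x ^ 2 / 2)) * Real.exp (-(s / x))) := by
      field_simp
    rw [this, mul_assoc, ← Real.exp_add, ← Real.exp_add]
    congr 2
    ring
  · rw [EventuallyLE, ae_restrict_iff' measurableSet_Ioi]
    refine Eventually.of_forall fun x hx => ?_
    have hx0 : 0 < x := hx
    rw [Pi.zero_apply]
    positivity

theorem gaussLaplace_strictAnti {γ s s' : ℝ} (hγ : 0 < γ) (hs : 0 ≤ s) (hss : s < s') :
    gaussLaplace γ s' < gaussLaplace γ s := by
  have hi := integrableOn_gaussLaplace hγ hs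
  have hi' := integrableOn_gaussLaplace hγ (hs.trans hss.le)
  have hsub : IntegrableOn (fun x : ℝ =>
      γ * x * Real.exp (-(γ * x ^ 2 / 2)) * Real.exp (-(s / x)) -
        γ * x * Real.exp (-(γ * x ^ 2 / 2)) * Real.exp (-(s' / x))) (Set.Ioi 0) := hi.sub hi'
  rw [← sub_pos, gaussLaplace, gaussLaplace, ← integral_sub hi hi',
    setIntegral_pos_iff_support_of_nonneg_ae _ hsub]
  · have : Set.Ioi (0 : ℝ) ⊆ (Function.support fun x : ℝ =>
        γ * x * Real.exp (-(γ * x ^ 2 / 2)) * Real.exp (-(s / x)) -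
          γ * x * Real.exp (-(γ * x ^ 2 / 2)) * Real.exp (-(s' / x))) ∩ Set.Ioi 0 := by
      intro x hx
      have hx0 : 0 < x := hx
      refine ⟨(sub_pos.2 ?_).ne', hx⟩
      gcongr
    exact lt_of_lt_of_le (by simp) (measure_mono this)
  · rw [EventuallyLE, ae_restrict_iff' measurableSet_Ioi]
    refine Eventually.of_forall fun x hx => ?_
    have hx0 : 0 < x := hx
    refine sub_nonneg.2 ?_
    gcongr

theorem integral_exp_wall {γ : ℝ} (hγ : 0 < γ) :
    γ * ∫ x in Set.Ioi (0 : ℝ), x ^ (0 : ℝ) * Real.exp (-(γ * x ^ 2 / 2)) =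
      Real.sqrt (Real.pi / 2) * Real.sqrt γ := by
  rw [integral_rpow_wall hγ (by norm_num), zero_add, Real.Gamma_one_half_eq,
    neg_div, Real.rpow_neg (by positivity), ← Real.sqrt_eq_rpow, Real.sqrt_div hγ.le,
    Real.sqrt_div Real.pi_pos.le, inv_div]
  have h2 : Real.sqrt 2 ^ 2 = 2 := Real.sq_sqrt (by norm_num)
  have hg : Real.sqrt γ ^ 2 = γ := Real.sq_sqrt hγ.le
  have : 0 < Real.sqrt γ := Real.sqrt_pos.2 hγ
  have : 0 < Real.sqrt 2 := Real.sqrt_pos.2 two_pos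
  field_simp
  rw [hg, h2]

theorem one_sub_le_gaussLaplace {γ s : ℝ} (hγ : 0 < γ) (hs : 0 ≤ s) :
    1 - Real.sqrt (Real.pi / 2) * Real.sqrt γ * s ≤ gaussLaplace γ s := by
  have h0 := integrableOn_gaussLaplace hγ le_rfl
  have hr := integrableOn_rpow_wall hγ (r := 0) (by norm_num)
  rw [← gaussLaplace_zero hγ, ← integral_exp_wall hγ, mul_right_comm, ← integral_const_mul,
    gaussLaplace, gaussLaplace, ← integral_sub h0 (hr.const_mul _)]
  refine setIntegral_mono_on (h0.sub (hr.const_mul _)) (integrableOn_gaussLaplace hγ hs)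
    measurableSet_Ioi fun x hx => ?_
  have hx0 : 0 < x := hx
  have h1 := Real.add_one_le_exp (-(s / x))
  have h2 : 0 ≤ γ * x * Real.exp (-(γ * x ^ 2 / 2)) := by positivity
  have h3 := mul_le_mul_of_nonneg_left h1 h2
  refine le_trans (le_of_eq ?_) h3
  rw [Real.rpow_zero, zero_div, neg_zero, Real.exp_zero]
  field_simp
  ring

/-- The remainder has exponent 3/2 rather than 2 because `p⁻²` is not integrable against `p exp (-γ
p² / 2) dp` near 0, whereas `p^(-3/2)` is. -/
theorem exp_neg_le {y : ℝ} (hy : 0 ≤ y) : Real.exp (-y) ≤ 1 - y + y * Real.sqrt y := by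
  rcases le_total y 1 with h | h
  · have h1 := (abs_le.1 (Real.abs_exp_sub_one_sub_id_le (x := -y) (by rwa [abs_neg, abs_of_nonneg hy]))).2
    have h2 : Real.sqrt y ≤ 1 := Real.sqrt_le_one.2 h
    have h3 : y ≤ Real.sqrt y := by
      nlinarith [Real.sq_sqrt hy, Real.sqrt_nonneg y]
    nlinarith
  · have h1 : Real.exp (-y) ≤ 1 := Real.exp_le_one_iff.2 (neg_nonpos.2 hy)
    have h2 : 1 ≤ Real.sqrt y := Real.one_le_sqrt.2 h
    nlinarith

/-- The factor of `s^{3/2}` in the upper bound of `gaussLaplace γ s`. -/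
def laplaceError (γ : ℝ) : ℝ := γ * ((γ / 2) ^ (-(1 / 4) : ℝ) * (1 / 2) * Real.Gamma (1 / 4))

theorem gaussLaplace_le {γ s : ℝ} (hγ : 0 < γ) (hs : 0 ≤ s) :
    gaussLaplace γ s ≤ 1 - Real.sqrt (Real.pi / 2) * Real.sqrt γ * s +
      laplaceError γ * (s * Real.sqrt s) := by
  have h0 := integrableOn_gaussLaplace hγ le_rfl
  have hr := integrableOn_rpow_wall hγ (r := 0) (by norm_num)
  have hr' := integrableOn_rpow_wall hγ (r := -(1 / 2)) (by norm_num)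
  have hv : laplaceError γ =
      γ * ∫ x in Set.Ioi (0 : ℝ), x ^ (-(1 / 2) : ℝ) * Real.exp (-(γ * x ^ 2 / 2)) := by
    rw [integral_rpow_wall hγ (by norm_num), laplaceError]
    norm_num
  rw [← gaussLaplace_zero hγ, ← integral_exp_wall hγ, hv, mul_right_comm γ _ s,
    mul_right_comm γ _ (s * _),
    ← integral_const_mul, ← integral_const_mul, gaussLaplace, gaussLaplace,
    ← integral_sub h0 (hr.const_mul _),
    ← integral_add (by exact h0.sub (hr.const_mul _)) (hr'.const_mul _)]
  refine setIntegral_mono_on (integrableOn_gaussLaplace hγ hs)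
    ((h0.sub (hr.const_mul _)).add (hr'.const_mul _)) measurableSet_Ioi fun x hx => ?_
  have hx0 : 0 < x := hx
  have h2 : 0 ≤ γ * x * Real.exp (-(γ * x ^ 2 / 2)) := by positivity
  have h3 := mul_le_mul_of_nonneg_left (exp_neg_le (div_nonneg hs hx0.le)) h2
  refine h3.trans (le_of_eq ?_)
  have hx1 : 0 < Real.sqrt x := Real.sqrt_pos.2 hx0
  rw [Real.rpow_zero, zero_div, neg_zero, Real.exp_zero, Real.sqrt_div hs, Real.rpow_neg hx0.le,
    ← Real.sqrt_eq_rpow]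
  field_simp

/-- Follows from `exp (-y) ≤ 1 / y`. This decay makes the cycle mass drop below 1 for large `s`. -/
theorem gaussLaplace_le_div {γ : ℝ} (hγ : 0 < γ) :
    ∃ K : ℝ, ∀ s : ℝ, 0 < s → gaussLaplace γ s ≤ K / s := by
  have hr := integrableOn_rpow_wall hγ (r := 2) (by norm_num)
  refine ⟨γ * ∫ x in Set.Ioi (0 : ℝ), x ^ (2 : ℝ) * Real.exp (-(γ * x ^ 2 / 2)), fun s hs => ?_⟩
  rw [mul_div_right_comm, ← integral_const_mul, gaussLaplace]
  refine setIntegral_mono_on (integrableOn_gaussLaplace hγ hs.le) (hr.const_mul _)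
    measurableSet_Ioi fun x hx => ?_
  have hx0 : 0 < x := hx
  have h1 : Real.exp (-(s / x)) ≤ x / s := by
    rw [Real.exp_neg, inv_le_comm₀ (Real.exp_pos _) (by positivity), inv_div]
    linarith [Real.add_one_le_exp (s / x)]
  have h2 : 0 ≤ γ * x * Real.exp (-(γ * x ^ 2 / 2)) := by positivity
  refine (mul_le_mul_of_nonneg_left h1 h2).trans (le_of_eq ?_)
  rw [Real.rpow_two]
  field_simp

/-! ### Growth of the path mass -/

/-- Each factor `E exp (-1 / p)` is below 1, so the expectations of `exp (-elapsed ω n)` are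
summable in `n`; hence this quantity tends to 0 almost surely and collisions do not accumulate. -/
theorem ae_tendsto_elapsed {b : ℕ → ℝ} (hb : ∀ k, 0 < b k) (hper : ∀ k, b (k + 2) = b k) :
    ∀ᵐ ω ∂(Measure.infinitePi fun k => wallLaw (b k)),
      (∀ k, 0 < ω k) ∧ Tendsto (elapsed ω) atTop atTop := by
  have := fun k => isProbabilityMeasure_wallLaw (hb k)
  refine Filter.Eventually.and ?_ ?_
  · exact ae_all_iff.2 fun k =>
      (measurePreserving_eval_infinitePi (fun k => wallLaw (b k)) k).quasiMeasurePreserving.ae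
        (ae_pos_wallLaw (b k))
  have hlt : ∀ k, tiltMass (b k) 0 1 < 1 := fun k => by
    rw [tiltMass_eq (hb k) (hb k) zero_le_one, sub_zero, div_self (hb k).ne', one_mul,
      ENNReal.ofReal_lt_one]
    exact (gaussLaplace_strictAnti (hb k) le_rfl one_pos).trans_eq (gaussLaplace_zero (hb k))
  have hm : ∀ n, Measurable fun ω : ℕ → ℝ => ∏ k ∈ Finset.range n,
      ENNReal.ofReal (Real.exp (0 * ω k ^ 2 / 2 - 1 / ω k)) := fun n =>
    Finset.measurable_fun_prod _ fun k _ => (measurable_tilt _ _).comp (measurable_pi_apply k)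
  have hfin : ∫⁻ ω, ∑' n : ℕ, ∏ k ∈ Finset.range n,
      ENNReal.ofReal (Real.exp (0 * ω k ^ 2 / 2 - 1 / ω k))
        ∂(Measure.infinitePi fun k => wallLaw (b k)) ≠ ⊤ := by
    rw [lintegral_tsum fun n => (hm n).aemeasurable]
    simp_rw [lintegral_infinitePi_prod_range (fun k => wallLaw (b k)) _
      fun k => measurable_tilt 0 1]
    refine tsum_prod_range_ne_top (m := fun k => tiltMass (b k) 0 1) (fun k => by rw [hper])
      (hlt 0).ne_top ?_
    exact (mul_le_of_le_one_right' (hlt 1).le).trans_lt (hlt 0)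
  filter_upwards [ae_lt_top (Measurable.tsum hm) hfin] with ω hω
  have h0 := ENNReal.tendsto_atTop_zero_of_tsum_ne_top hω.ne
  refine tendsto_atTop.2 fun R => ?_
  filter_upwards [h0.eventually_lt_const (ENNReal.ofReal_pos.2 (Real.exp_pos (-R)))] with n hn
  rw [← ENNReal.ofReal_prod_of_nonneg fun _ _ => (Real.exp_pos _).le, ← Real.exp_sum,
    ENNReal.ofReal_lt_ofReal_iff (Real.exp_pos _), Real.exp_lt_exp] at hn
  simp only [zero_mul, zero_div, zero_sub, Finset.sum_neg_distrib, neg_lt_neg_iff] at hn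
  exact hn.le

/-- The part of `tiltMass β θ s` that comes from the speeds in `[1 / (n + 1), n + 1]`. -/
def truncMass (β θ s : ℝ) (n : ℕ) : ENNReal :=
  ∫⁻ x in Set.Icc (1 / ((n : ℝ) + 1)) (n + 1),
    ENNReal.ofReal (Real.exp (θ * x ^ 2 / 2 - s / x)) ∂wallLaw β

theorem tendsto_truncMass (β θ s : ℝ) :
    Tendsto (truncMass β θ s) atTop (𝓝 (tiltMass β θ s)) := by
  have hcov : AECover (wallLaw β) atTop
      fun n : ℕ => Set.Icc (1 / ((n : ℝ) + 1)) ((n : ℝ) + 1) := by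
    refine ⟨?_, fun n => measurableSet_Icc⟩
    filter_upwards [ae_pos_wallLaw β] with x hx
    have h1 := tendsto_one_div_add_atTop_nhds_zero_nat (𝕜 := ℝ)
    have h2 : Tendsto (fun n : ℕ => (n : ℝ) + 1) atTop atTop :=
      tendsto_atTop_add_const_right _ _ tendsto_natCast_atTop_atTop
    filter_upwards [h1.eventually_lt_const hx, h2.eventually_gt_atTop x] with n hn hn'
    exact ⟨hn.le, hn'.le⟩
  exact hcov.lintegral_tendsto_of_nat (measurable_tilt θ s).aemeasurable

theorem truncMass_le (β θ s : ℝ) (n : ℕ) : truncMass β θ s n ≤ tiltMass β θ s :=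
  setLIntegral_le_lintegral _ _

theorem setLIntegral_le_pathMass {b : ℕ → ℝ} (hb : ∀ k, 0 < b k) (θ : ℕ → ℝ) (t : ℝ) (A : Set ℝ) :
    ∫⁻ x in A, ENNReal.ofReal (Real.exp (θ 0 * x ^ 2 / 2)) *
      pathMass (fun k => b (k + 1)) (fun k => θ (k + 1)) (t - 1 / x) ∂wallLaw (b 0) ≤
      pathMass b θ t := by
  rw [pathMass_eq hb]
  exact (setLIntegral_le_lintegral _ _).trans (lintegral_mono fun x => le_add_self)

/-- An exponential lower bound survives one flight: the loss `exp (-s / x)` for the time spent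
combines with the energy weight into the tilted mass. -/
theorem mul_truncMass_le_pathMass {b : ℕ → ℝ} (hb : ∀ k, 0 < b k) (θ : ℕ → ℝ) {s t : ℝ} {n : ℕ}
    {K : ENNReal} (h : ∀ x ∈ Set.Icc (1 / ((n : ℝ) + 1)) (n + 1),
      K * ENNReal.ofReal (Real.exp (s * (t - 1 / x))) ≤
        pathMass (fun k => b (k + 1)) (fun k => θ (k + 1)) (t - 1 / x)) :
    K * ENNReal.ofReal (Real.exp (s * t)) * truncMass (b 0) (θ 0) s n ≤ pathMass b θ t := by
  refine le_trans ?_ (setLIntegral_le_pathMass hb θ t (Set.Icc (1 / ((n : ℝ) + 1)) (n + 1)))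
  rw [truncMass, ← lintegral_const_mul _ (measurable_tilt _ _)]
  refine setLIntegral_mono' measurableSet_Icc fun x hx => ?_
  refine le_trans (le_of_eq ?_) (mul_le_mul_right (h x hx) _)
  rw [mul_assoc, mul_left_comm _ K, ← ENNReal.ofReal_mul (Real.exp_pos _).le,
    ← ENNReal.ofReal_mul (Real.exp_pos _).le, ← Real.exp_add, ← Real.exp_add]
  congr 3
  ring

theorem exists_mul_exp_le_pathMass {b θ : ℕ → ℝ} (hb : ∀ k, 0 < b k) (hbp : ∀ k, b (k + 2) = b k)
    (hθp : ∀ k, θ (k + 2) = θ k) {s : ℝ} (hs : 0 ≤ s) (h0 : tiltMass (b 0) (θ 0) s ≠ ⊤)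
    (h1 : tiltMass (b 1) (θ 1) s ≠ ⊤)
    (h : 1 < tiltMass (b 0) (θ 0) s * tiltMass (b 1) (θ 1) s) :
    ∃ c : ENNReal, c ≠ 0 ∧ ∀ t : ℝ, 0 ≤ t →
      c * ENNReal.ofReal (Real.exp (s * t)) ≤ pathMass b θ t := by
  have hb' : ∀ k, 0 < b (k + 1) := fun k => hb _
  -- Truncation keeps the cycle supercritical while every flight lasts between `1 / A` and `A`,
  -- where `A = n + 1`; this permits an induction on time.
  obtain ⟨n, hn⟩ : ∃ n, 1 < truncMass (b 0) (θ 0) s n * truncMass (b 1) (θ 1) s n :=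
    ((ENNReal.Tendsto.mul (tendsto_truncMass _ _ _) (Or.inr h1) (tendsto_truncMass _ _ _)
      (Or.inr h0)).eventually_const_lt h).exists
  set m₀ := truncMass (b 0) (θ 0) s n
  set m₁ := truncMass (b 1) (θ 1) s n
  have hm0 : m₀ ≠ 0 := by rintro h; simp [h] at hn
  have hm0' : m₀ ≠ ⊤ := ne_top_of_le_ne_top h0 (truncMass_le _ _ _ _)
  set A : ℝ := n + 1 with hA
  have hApos : 0 < A := by positivity
  have hApos' : (0 : ℝ) < 1 / (A + 1) := by positivity
  set w₀ := wallLaw (b 0) (Set.Ioo 0 (1 / (A + 1)))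
  set w₁ := wallLaw (b 1) (Set.Ioo 0 (1 / (A + 1)))
  have hw0 : w₀ ≠ 0 := (wallLaw_Ioo_pos (hb 0) le_rfl hApos').ne'
  have hw1 : w₁ ≠ 0 := (wallLaw_Ioo_pos (hb 1) le_rfl hApos').ne'
  -- Chosen so that for `t ≤ A` the event of no completed flight already gives both bounds.
  set c := min (w₀ / m₀) w₁ * ENNReal.ofReal (Real.exp (-(s * A))) with hc
  have hc0 : c ≠ 0 := by
    refine mul_ne_zero ?_ (ENNReal.ofReal_pos.2 (Real.exp_pos _)).ne'
    rw [← pos_iff_ne_zero, lt_min_iff, pos_iff_ne_zero, pos_iff_ne_zero]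
    exact ⟨ENNReal.div_ne_zero.2 ⟨hw0, hm0'⟩, hw1⟩
  have hexp : ∀ t ≤ A, c * ENNReal.ofReal (Real.exp (s * t)) ≤ min (w₀ / m₀) w₁ := fun t ht => by
    rw [hc, mul_assoc, ← ENNReal.ofReal_mul (Real.exp_pos _).le, ← Real.exp_add]
    refine mul_le_of_le_one_right' (ENNReal.ofReal_le_one.2 (Real.exp_le_one_iff.2 ?_))
    nlinarith
  -- The two starting walls get the constants `c * m₀` and `c`: a flight from the first passes from
  -- `c` to `c * m₀` exactly, and a flight from the second passes from `c * m₀` to `c * m₀ * m₁ ≥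
  -- c`.
  have key : ∀ k : ℕ, ∀ t : ℝ, 0 ≤ t → t ≤ A + k * (1 / A) →
      c * m₀ * ENNReal.ofReal (Real.exp (s * t)) ≤ pathMass b θ t ∧
      c * ENNReal.ofReal (Real.exp (s * t)) ≤
        pathMass (fun k => b (k + 1)) (fun k => θ (k + 1)) t := by
    have base : ∀ t : ℝ, 0 ≤ t → t ≤ A →
        c * m₀ * ENNReal.ofReal (Real.exp (s * t)) ≤ pathMass b θ t ∧
        c * ENNReal.ofReal (Real.exp (s * t)) ≤
          pathMass (fun k => b (k + 1)) (fun k => θ (k + 1)) t := by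
      intro t ht htA
      refine ⟨le_trans ?_ (wallLaw_le_pathMass hb θ ht (htA.trans_lt (lt_add_one A))),
        le_trans ?_ (wallLaw_le_pathMass hb' _ ht (htA.trans_lt (lt_add_one A)))⟩
      · rw [mul_right_comm]
        refine (mul_le_mul_left ((hexp t htA).trans (min_le_left _ _)) m₀).trans ?_
        exact ENNReal.mul_le_of_le_div le_rfl
      · exact (hexp t htA).trans (min_le_right _ _)
    intro k
    induction k with
    | zero => intro t ht htA; exact base t ht (by simpa using htA)
    | succ k ih =>
      intro t ht htk
      rcases le_or_gt t A with htA | htA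
      · exact base t ht htA
      -- A flight costs at most `A < t`, so the remaining time is nonnegative, and at least `1 / A`,
      -- so it falls into the previous window.
      have hx : ∀ x ∈ Set.Icc (1 / A) A, 0 ≤ t - 1 / x ∧ t - 1 / x ≤ A + k * (1 / A) := by
        intro x hx
        have hx0 : 0 < x := (one_div_pos.2 hApos).trans_le hx.1
        have h1 : 1 / x ≤ A := (one_div_le hApos hx0).1 hx.1
        have h2 : 1 / A ≤ 1 / x := one_div_le_one_div_of_le hx0 hx.2
        push_cast at htk
        constructor <;> linarith
      constructor
      · rw [mul_right_comm]
        exact mul_truncMass_le_pathMass hb θ fun x hx' => (ih _ (hx x hx').1 (hx x hx').2).2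
      · have h2 := mul_truncMass_le_pathMass (s := s) (t := t) (n := n) (K := c * m₀) hb'
          (fun k => θ (k + 1)) fun x hx' => by
            simp only [add_assoc, Nat.reduceAdd, hbp, hθp]
            exact (ih _ (hx x hx').1 (hx x hx').2).1
        refine le_trans ?_ h2
        calc c * ENNReal.ofReal (Real.exp (s * t))
            ≤ c * ENNReal.ofReal (Real.exp (s * t)) * (m₀ * m₁) := le_mul_of_one_le_right' hn.le
          _ = c * m₀ * ENNReal.ofReal (Real.exp (s * t)) * m₁ := by ring
  refine ⟨c * m₀, mul_ne_zero hc0 hm0, fun t ht => ?_⟩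
  obtain ⟨k, hk⟩ := exists_nat_ge ((t - A) / (1 / A))
  rw [div_le_iff₀ (by positivity)] at hk
  exact (key k t ht (by linarith)).1

/-- The energy weight beats the Gaussian tail, so speeds above `1 / t`, whose flights end by time
`t`, have infinite weighted mass; a slow second flight contributes a positive factor independent of
the first speed. -/
theorem pathMass_eq_top_of_le {b θ : ℕ → ℝ} (hb : ∀ k, 0 < b k) (h : b 0 ≤ θ 0) {t : ℝ}
    (ht : 0 < t) : pathMass b θ t = ⊤ := by
  have hb' : ∀ k, 0 < b (k + 1) := fun k => hb _
  have ht' : 0 < 1 / t := one_div_pos.2 ht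
  set w := wallLaw (b 1) (Set.Ioo 0 (1 / (t + 1)))
  have hw : w ≠ 0 := (wallLaw_Ioo_pos (hb 1) le_rfl (by positivity)).ne'
  refine top_le_iff.1 (le_trans ?_ (setLIntegral_le_pathMass hb θ t (Set.Ici (1 / t))))
  have h1 : ∫⁻ x in Set.Ici (1 / t), ENNReal.ofReal (Real.exp (θ 0 * x ^ 2 / 2)) * w
      ∂wallLaw (b 0) ≤ _ := setLIntegral_mono' measurableSet_Ici fun x hx => by
    have hx0 : 0 < x := ht'.trans_le hx
    have hx1 : 1 / x ≤ t := (one_div_le ht hx0).1 hx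
    exact mul_le_mul_right (wallLaw_le_pathMass hb' (fun k => θ (k + 1)) (sub_nonneg.2 hx1)
      (by linarith [one_div_pos.2 hx0] : t - 1 / x < t + 1)) _
  refine le_trans ?_ h1
  rw [lintegral_mul_const _ (by fun_prop), ← lintegral_indicator measurableSet_Ici,
    lintegral_wallLaw _ (Measurable.indicator (by fun_prop) measurableSet_Ici)]
  have h2 : ∫⁻ x in Set.Ici (1 / t), ENNReal.ofReal (b 0 * (1 / t)) ≤
      ∫⁻ x in Set.Ioi 0, ENNReal.ofReal (b 0 * x * Real.exp (-(b 0 * x ^ 2 / 2))) *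
        (Set.Ici (1 / t)).indicator (fun x => ENNReal.ofReal (Real.exp (θ 0 * x ^ 2 / 2))) x := by
    refine le_trans ?_ (lintegral_mono_set (Set.Ici_subset_Ioi.2 ht'))
    refine setLIntegral_mono' measurableSet_Ici fun x hx => ?_
    have hx0 : 0 < x := ht'.trans_le hx
    have hb0 := hb 0
    rw [Set.indicator_of_mem hx, ← ENNReal.ofReal_mul (by positivity)]
    refine ENNReal.ofReal_le_ofReal ?_
    rw [mul_assoc, ← Real.exp_add]
    refine (mul_le_mul_of_nonneg_left hx hb0.le).trans (le_mul_of_one_le_right (by positivity) ?_)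
    rw [Real.one_le_exp_iff]
    nlinarith [mul_nonneg (sub_nonneg.2 h) (sq_nonneg x)]
  have h3 : ∫⁻ x in Set.Ici (1 / t), ENNReal.ofReal (b 0 * (1 / t)) = ⊤ := by
    have : 0 < b 0 * (1 / t) := mul_pos (hb 0) ht'
    rw [setLIntegral_const, Real.volume_Ici, ENNReal.mul_top]
    simpa using this
  rw [top_le_iff.1 (h3.symm.le.trans h2), ENNReal.top_mul hw]

/-- With positive probability the first flight leaves a positive time, during which the infinite
mass of the other wall is already reached. -/
theorem pathMass_eq_top_of_shift {b θ : ℕ → ℝ} (hb : ∀ k, 0 < b k)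
    (h : ∀ t : ℝ, 0 < t → pathMass (fun k => b (k + 1)) (fun k => θ (k + 1)) t = ⊤) {t : ℝ}
    (ht : 0 < t) : pathMass b θ t = ⊤ := by
  have ht' : 0 < 1 / t := one_div_pos.2 ht
  refine top_le_iff.1 (le_trans ?_
    (setLIntegral_le_pathMass hb θ t (Set.Ioo (1 / t) (1 / t + 1))))
  have h1 : ∫⁻ x in Set.Ioo (1 / t) (1 / t + 1), ENNReal.ofReal (Real.exp (θ 0 * x ^ 2 / 2)) *
      pathMass (fun k => b (k + 1)) (fun k => θ (k + 1)) (t - 1 / x) ∂wallLaw (b 0) =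
      ∫⁻ _x in Set.Ioo (1 / t) (1 / t + 1), ⊤ ∂wallLaw (b 0) :=
    setLIntegral_congr_fun measurableSet_Ioo fun x hx => by
      have hx0 : 0 < x := ht'.trans hx.1
      simp only [h _ (sub_pos.2 ((one_div_lt ht hx0).1 hx.1))]
      rw [ENNReal.mul_top]
      simpa using Real.exp_pos _
  rw [h1, setLIntegral_const, ENNReal.top_mul
    (wallLaw_Ioo_pos (hb 0) ht'.le (lt_add_one _)).ne']

/-! ### The cumulant generating function -/

/-- Exponential growth at rate `f` gives the limit `f` of `(1/t) log`. -/
theorem tendsto_one_div_mul_log {g : ℝ → ENNReal} {f : ℝ}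
    (hub : ∀ s, f < s → ∃ C : ℝ, 0 < C ∧ ∀ᶠ t in atTop, g t ≤ ENNReal.ofReal (C * Real.exp (s * t)))
    (hlb : ∀ s, s < f → ∃ C : ℝ, 0 < C ∧ ∀ᶠ t in atTop, ENNReal.ofReal (C * Real.exp (s * t)) ≤ g t) :
    Tendsto (fun t : ℝ => ((1 / t : ℝ) : EReal) * ENNReal.log (g t)) atTop (𝓝 (f : EReal)) := by
  have hval : ∀ C s t : ℝ, 0 < C → 0 < t → ((1 / t : ℝ) : EReal) *
      ENNReal.log (ENNReal.ofReal (C * Real.exp (s * t))) = ((Real.log C / t + s : ℝ) : EReal) := by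
    intro C s t hC ht
    rw [ENNReal.log_ofReal_of_pos (by positivity), ← EReal.coe_mul,
      Real.log_mul hC.ne' (Real.exp_pos _).ne', Real.log_exp]
    congr 1
    field_simp
  have hlim : ∀ C s : ℝ, Tendsto (fun t : ℝ => Real.log C / t + s) atTop (𝓝 s) := fun C s => by
    simpa using (tendsto_const_nhds.div_atTop tendsto_id).add_const s
  refine tendsto_order.2 ⟨fun a ha => ?_, fun a ha => ?_⟩
  · obtain ⟨x, hx, hxf⟩ := EReal.lt_iff_exists_real_btwn.1 ha
    obtain ⟨s, hxs, hs⟩ := exists_between (EReal.coe_lt_coe_iff.1 hxf)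
    obtain ⟨C, hC, h⟩ := hlb s hs
    filter_upwards [h, eventually_gt_atTop 0, (hlim C s).eventually_const_lt hxs] with t h1 ht h2
    refine (hx.trans (EReal.coe_lt_coe_iff.2 h2)).trans_le ?_
    rw [← hval C s t hC ht]
    exact mul_le_mul_of_nonneg_left (ENNReal.log_le_log h1)
      (EReal.coe_nonneg.2 (one_div_pos.2 ht).le)
  · obtain ⟨x, hxf, hx⟩ := EReal.lt_iff_exists_real_btwn.1 ha
    obtain ⟨s, hs, hxs⟩ := exists_between (EReal.coe_lt_coe_iff.1 hxf)
    obtain ⟨C, hC, h⟩ := hub s hs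
    filter_upwards [h, eventually_gt_atTop 0, (hlim C s).eventually_lt_const hxs] with t h1 ht h2
    refine lt_of_le_of_lt ?_ ((EReal.coe_lt_coe_iff.2 h2).trans hx)
    rw [← hval C s t hC ht]
    exact mul_le_mul_of_nonneg_left (ENNReal.log_le_log h1)
      (EReal.coe_nonneg.2 (one_div_pos.2 ht).le)

/-- The density vanishes only linearly at 0, so the probability is at least of order `(t + 1)⁻²`,
larger than any decaying exponential up to a constant. This keeps the growth rate from being
negative. -/
theorem exists_mul_exp_le_wallLaw {β u : ℝ} (hβ : 0 < β) (hu : 0 < u) :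
    ∃ C : ℝ, 0 < C ∧ ∀ t : ℝ, 0 ≤ t →
      ENNReal.ofReal (C * Real.exp (-u * t)) ≤ wallLaw β (Set.Ioo 0 (1 / (t + 1))) := by
  refine ⟨β * Real.exp (-(β / 2)) / 4 * (u ^ 2 / 4 * Real.exp (-u)), by positivity, fun t ht => ?_⟩
  set r := 1 / (t + 1) with hr
  have hr0 : 0 < r := by positivity
  have hr1 : r ≤ 1 := by rw [hr, div_le_one (by positivity)]; linarith
  have h1 : ENNReal.ofReal (β * Real.exp (-(β / 2)) / 4 * r ^ 2) ≤ wallLaw β (Set.Ioo 0 r) := by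
    rw [← lintegral_indicator_one measurableSet_Ioo,
      lintegral_wallLaw β (measurable_one.indicator measurableSet_Ioo)]
    -- On the upper half of the interval the density has a constant lower bound of order `r`,
    -- because `r ≤ 1`.
    have h2 : ∫⁻ x in Set.Ioo (r / 2) r, ENNReal.ofReal (β * (r / 2) * Real.exp (-(β / 2))) ≤
        ∫⁻ x in Set.Ioi 0, ENNReal.ofReal (β * x * Real.exp (-(β * x ^ 2 / 2))) *
          (Set.Ioo 0 r).indicator 1 x := by
      refine le_trans ?_ (lintegral_mono_set
        (fun x hx => (half_pos hr0).trans hx.1 : Set.Ioo (r / 2) r ⊆ Set.Ioi 0))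
      refine setLIntegral_mono' measurableSet_Ioo fun x hx => ?_
      have hx0 : 0 < x := (half_pos hr0).trans hx.1
      rw [Set.indicator_of_mem (Set.mem_Ioo.2 ⟨hx0, hx.2⟩), Pi.one_apply, mul_one]
      have hx1 : x ^ 2 ≤ 1 := pow_le_one₀ hx0.le (hx.2.le.trans hr1)
      have := hx.1
      refine ENNReal.ofReal_le_ofReal ?_
      gcongr
      nlinarith
    refine le_trans (le_of_eq ?_) h2
    rw [setLIntegral_const, Real.volume_Ioo, ← ENNReal.ofReal_mul (by positivity)]
    congr 1
    ring
  refine le_trans (ENNReal.ofReal_le_ofReal ?_) h1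
  rw [mul_assoc]
  refine mul_le_mul_of_nonneg_left ?_ (by positivity)
  have h3 : u * (t + 1) / 2 ≤ Real.exp (u * (t + 1) / 2) := by
    linarith [Real.add_one_le_exp (u * (t + 1) / 2)]
  have h4 : (u * (t + 1) / 2) ^ 2 ≤ Real.exp (u * (t + 1)) := by
    refine (pow_le_pow_left₀ (by positivity) h3 2).trans (le_of_eq ?_)
    rw [← Real.exp_nat_mul]
    congr 1
    push_cast
    ring
  have h5 : u ^ 2 / 4 * Real.exp (-u) * Real.exp (-u * t) =
      (u * (t + 1) / 2) ^ 2 * r ^ 2 / Real.exp (u * (t + 1)) := by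
    rw [mul_assoc, ← Real.exp_add, show -u + -u * t = -(u * (t + 1)) by ring, Real.exp_neg, hr]
    field_simp
    norm_num
  rw [h5, div_le_iff₀ (Real.exp_pos _), mul_comm (r ^ 2)]
  exact mul_le_mul_of_nonneg_right h4 (by positivity)

theorem wallBeta_pos {βL βR : ℝ} (hL : 0 < βL) (hR : 0 < βR) (σ : ℝ) : 0 < wallBeta βL βR σ := by
  unfold wallBeta
  split_ifs <;> assumption

theorem flightSign_add_two (p₀ : ℝ) (k : ℕ) : flightSign p₀ (k + 2) = flightSign p₀ k := by
  simp [flightSign, pow_add]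

theorem scaledCumulant_eq (q₀ l : ℝ) {p₀ βL βR t : ℝ} (hp₀ : p₀ ≠ 0) (hL : 0 < βL) (hR : 0 < βR)
    (ht : firstCollision q₀ p₀ ≤ t) :
    scaledCumulant q₀ p₀ βL βR l t = ((1 / t : ℝ) : EReal) * ENNReal.log
      (pathMass (fun k => wallBeta βL βR (flightSign p₀ k)) (fun k => l * flightSign p₀ (k + 1))
        (t - firstCollision q₀ p₀)) := by
  rw [scaledCumulant, pathMass, speedLaw]
  congr 2
  refine lintegral_congr_ae ?_
  filter_upwards [ae_tendsto_elapsed (b := fun k => wallBeta βL βR (flightSign p₀ k))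
    (fun k => wallBeta_pos hL hR _) fun k => by rw [flightSign_add_two]] with ω hω
  exact ofReal_exp_energyCurrent q₀ l hp₀ ht hω.1 hω.2

/-- The first two parameters of the two-periodic sequences. -/
theorem wall_cases {p₀ : ℝ} (hp₀ : p₀ ≠ 0) (βL βR l : ℝ) :
    (wallBeta βL βR (flightSign p₀ 0) = βL ∧ l * flightSign p₀ (0 + 1) = l ∧
      wallBeta βL βR (flightSign p₀ 1) = βR ∧ l * flightSign p₀ (1 + 1) = -l) ∨
    (wallBeta βL βR (flightSign p₀ 0) = βR ∧ l * flightSign p₀ (0 + 1) = -l ∧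
      wallBeta βL βR (flightSign p₀ 1) = βL ∧ l * flightSign p₀ (1 + 1) = l) := by
  rcases lt_or_gt_of_ne hp₀ with h | h
  · left; norm_num [flightSign, Real.sign_of_neg h, wallBeta]
  · right; norm_num [flightSign, Real.sign_of_pos h, wallBeta]

theorem tendsto_scaledCumulant_top (q₀ : ℝ) {p₀ βL βR l : ℝ} (hp₀ : p₀ ≠ 0) (hL : 0 < βL)
    (hR : 0 < βR) (h : βL ≤ l ∨ βR ≤ -l) :
    Tendsto (fun t : ℝ => scaledCumulant q₀ p₀ βL βR l t) atTop (𝓝 ⊤) := by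
  have hb : ∀ k, 0 < wallBeta βL βR (flightSign p₀ k) := fun k => wallBeta_pos hL hR _
  have hor : wallBeta βL βR (flightSign p₀ 0) ≤ l * flightSign p₀ (0 + 1) ∨
      wallBeta βL βR (flightSign p₀ 1) ≤ l * flightSign p₀ (1 + 1) := by
    rcases wall_cases hp₀ βL βR l with ⟨h1, h2, h3, h4⟩ | ⟨h1, h2, h3, h4⟩
    · rw [h1, h2, h3, h4]; exact h
    · rw [h1, h2, h3, h4]; exact h.symm
  have htop : ∀ t : ℝ, 0 < t → pathMass (fun k => wallBeta βL βR (flightSign p₀ k))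
      (fun k => l * flightSign p₀ (k + 1)) t = ⊤ := by
    intro t ht
    rcases hor with h | h
    · exact pathMass_eq_top_of_le hb h ht
    · exact pathMass_eq_top_of_shift hb
        (fun t ht => pathMass_eq_top_of_le (fun k => hb (k + 1)) h ht) ht
  refine tendsto_const_nhds.congr' ?_
  filter_upwards [eventually_gt_atTop (firstCollision q₀ p₀), eventually_gt_atTop 0] with t ht ht0
  rw [scaledCumulant_eq q₀ l hp₀ hL hR ht.le, htop _ (sub_pos.2 ht), ENNReal.log_top,
    EReal.coe_mul_top_of_pos (one_div_pos.2 ht0)]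

/-- The mass of one cycle of two flights, tilted by `exp (-s * duration)`. -/
def cycleMass (βL βR l s : ℝ) : ℝ :=
  βL / (βL - l) * gaussLaplace (βL - l) s * (βR / (βR + l) * gaussLaplace (βR + l) s)

theorem cycleMass_strictAnti {βL βR l s s' : ℝ} (hL : 0 < βL) (hR : 0 < βR) (hl : l < βL)
    (hl' : -βR < l) (hs : 0 ≤ s) (hss : s < s') :
    cycleMass βL βR l s' < cycleMass βL βR l s := by
  have h1 : 0 < βL - l := by linarith
  have h2 : 0 < βR + l := by linarith
  have h3 := gaussLaplace_strictAnti h1 hs hss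
  have h4 := gaussLaplace_strictAnti h2 hs hss
  have h5 := gaussLaplace_pos h1 (hs.trans hss.le)
  have h6 := gaussLaplace_pos h2 (hs.trans hss.le)
  unfold cycleMass
  gcongr

theorem exists_cycleMass_lt_one {βL βR l : ℝ} (hL : 0 < βL) (hR : 0 < βR) (hl : l < βL)
    (hl' : -βR < l) : ∃ s : ℝ, 0 ≤ s ∧ cycleMass βL βR l s < 1 := by
  have h1 : 0 < βL - l := by linarith
  have h2 : 0 < βR + l := by linarith
  obtain ⟨K, hK⟩ := gaussLaplace_le_div h1
  obtain ⟨K', hK'⟩ := gaussLaplace_le_div h2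
  have hlim : Tendsto (fun s : ℝ => βL / (βL - l) * (K / s) * (βR / (βR + l) * (K' / s))) atTop
      (𝓝 (βL / (βL - l) * 0 * (βR / (βR + l) * 0))) :=
    ((tendsto_const_nhds.div_atTop tendsto_id).const_mul _).mul
      ((tendsto_const_nhds.div_atTop tendsto_id).const_mul _)
  obtain ⟨s, hs, hs0⟩ :=
    ((hlim.eventually_lt_const (u := 1) (by simp)).and (eventually_gt_atTop 0)).exists
  refine ⟨s, hs0.le, lt_of_le_of_lt ?_ hs⟩
  have h3 := hK s hs0
  have h4 := hK' s hs0
  have h5 := gaussLaplace_pos h1 hs0.le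
  have h6 := gaussLaplace_pos h2 hs0.le
  unfold cycleMass
  gcongr
  exact mul_nonneg (by positivity) (h5.le.trans h3)

/-- The rate is the infimum of the `s ≥ 0` with cycle mass below 1. Strict monotonicity separates
the two sides of the infimum, so neither continuity nor a root of `cycleMass = 1` is needed; the
infimum may be 0 with mass below 1 there. -/
theorem exists_growthRate (q₀ : ℝ) {p₀ βL βR l : ℝ} (hp₀ : p₀ ≠ 0) (hL : 0 < βL)
    (hR : 0 < βR) (hl : l < βL) (hl' : -βR < l) :
    ∃ f : ℝ, 0 ≤ f ∧
      Tendsto (fun t : ℝ => scaledCumulant q₀ p₀ βL βR l t) atTop (𝓝 (f : EReal)) ∧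
      (∀ s, 0 ≤ s → cycleMass βL βR l s < 1 → f ≤ s) ∧
      ∀ s, 0 ≤ s → 1 < cycleMass βL βR l s → s ≤ f := by
  have h1 : 0 < βL - l := by linarith
  have h2 : 0 < βR + l := by linarith
  set S := {s : ℝ | 0 ≤ s ∧ cycleMass βL βR l s < 1} with hS
  have hSne : S.Nonempty := exists_cycleMass_lt_one hL hR hl hl'
  have hSbdd : BddBelow S := ⟨0, fun s hs => hs.1⟩
  have hf0 : 0 ≤ sInf S := le_csInf hSne fun s hs => hs.1
  have habove : ∀ s, sInf S < s → cycleMass βL βR l s < 1 := fun s hs => by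
    obtain ⟨s', hs', hlt⟩ := exists_lt_of_csInf_lt hSne hs
    exact (cycleMass_strictAnti hL hR hl hl' hs'.1 hlt).trans hs'.2
  have hbelow : ∀ s, 0 ≤ s → s < sInf S → 1 < cycleMass βL βR l s := fun s hs0 hs => by
    obtain ⟨m, hsm, hm⟩ := exists_between hs
    refine lt_of_le_of_lt ?_ (cycleMass_strictAnti hL hR hl hl' hs0 hsm)
    by_contra hlt
    exact notMem_of_lt_csInf hm hSbdd ⟨hs0.trans hsm.le, not_le.1 hlt⟩
  set b : ℕ → ℝ := fun k => wallBeta βL βR (flightSign p₀ k) with hbdef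
  set θ : ℕ → ℝ := fun k => l * flightSign p₀ (k + 1) with hθdef
  set S₀ := firstCollision q₀ p₀
  have hb : ∀ k, 0 < b k := fun k => wallBeta_pos hL hR _
  have hbp : ∀ k, b (k + 2) = b k := fun k => by simp only [b, flightSign_add_two]
  have hθp : ∀ k, θ (k + 2) = θ k := fun k => by
    simp only [θ, show k + 2 + 1 = k + 1 + 2 by ring, flightSign_add_two]
  have hmass : ∀ s, 0 ≤ s → tiltMass (b 0) (θ 0) s ≠ ⊤ ∧ tiltMass (b 1) (θ 1) s ≠ ⊤ ∧
      tiltMass (b 0) (θ 0) s * tiltMass (b 1) (θ 1) s = ENNReal.ofReal (cycleMass βL βR l s) := by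
    intro s hs
    have e1 := tiltMass_eq hL hl hs
    have e2 := tiltMass_eq hR (neg_lt.1 hl') hs
    rw [sub_neg_eq_add] at e2
    have hg1 := gaussLaplace_pos h1 hs
    have e3 : tiltMass βL l s * tiltMass βR (-l) s = ENNReal.ofReal (cycleMass βL βR l s) := by
      rw [e1, e2, ← ENNReal.ofReal_mul (by positivity), cycleMass]
    rcases wall_cases hp₀ βL βR l with ⟨a1, a2, a3, a4⟩ | ⟨a1, a2, a3, a4⟩
    · simp only [b, θ, a1, a2, a3, a4]
      exact ⟨e1 ▸ ENNReal.ofReal_ne_top, e2 ▸ ENNReal.ofReal_ne_top, e3⟩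
    · simp only [b, θ, a1, a2, a3, a4]
      exact ⟨e2 ▸ ENNReal.ofReal_ne_top, e1 ▸ ENNReal.ofReal_ne_top, (mul_comm _ _).trans e3⟩
  have hshift : ∀ s t : ℝ, Real.exp (s * (t - S₀)) = Real.exp (-(s * S₀)) * Real.exp (s * t) :=
    fun s t => by rw [← Real.exp_add]; congr 1; ring
  refine ⟨sInf S, hf0, ?_, fun s hs h => csInf_le hSbdd ⟨hs, h⟩, fun s _ h => ?_⟩
  · have key : Tendsto (fun t : ℝ => ((1 / t : ℝ) : EReal) * ENNReal.log (pathMass b θ (t - S₀)))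
        atTop (𝓝 ((sInf S : ℝ) : EReal)) := by
      refine tendsto_one_div_mul_log (fun s hs => ?_) fun s hs => ?_
      · have hs0 : 0 ≤ s := hf0.trans hs.le
        obtain ⟨m1, m2, m3⟩ := hmass s hs0
        have hfin := tsum_prod_range_ne_top (m := fun k => tiltMass (b k) (θ k) s)
          (fun k => by simp only [hbp, hθp]) m1
          (m3.trans_lt (ENNReal.ofReal_lt_one.2 (habove s hs)))
        set Z := ∑' n : ℕ, ∏ k ∈ Finset.range n, tiltMass (b k) (θ k) s
        refine ⟨Real.exp (-(s * S₀)) * (Z.toReal + 1), by positivity, Eventually.of_forall fun t => ?_⟩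
        refine (pathMass_le hb θ (t - S₀) hs0).trans ?_
        rw [mul_right_comm, ← hshift, ENNReal.ofReal_mul (Real.exp_pos _).le]
        refine mul_le_mul_right ?_ _
        refine (ENNReal.ofReal_toReal hfin).symm.le.trans (ENNReal.ofReal_le_ofReal ?_)
        linarith
      -- For negative `s` one unfinished slow flight suffices; only `s ≥ 0` needs the supercritical
      -- renewal argument.
      · rcases lt_or_ge s 0 with hneg | hs0
        · obtain ⟨C, hC, h⟩ := exists_mul_exp_le_wallLaw (hb 0) (neg_pos.2 hneg)
          refine ⟨C * Real.exp (-(s * S₀)), by positivity, ?_⟩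
          filter_upwards [eventually_ge_atTop S₀] with t ht
          rw [mul_assoc, ← hshift]
          have := h (t - S₀) (sub_nonneg.2 ht)
          rw [neg_neg] at this
          exact this.trans (wallLaw_le_pathMass hb θ (sub_nonneg.2 ht) (lt_add_one _))
        · obtain ⟨m1, m2, m3⟩ := hmass s hs0
          obtain ⟨c, hc, h⟩ := exists_mul_exp_le_pathMass hb hbp hθp hs0 m1 m2
            (m3 ▸ ENNReal.one_lt_ofReal.2 (hbelow s hs0 hs))
          -- The constant `c` is only known to be nonzero; capping it at 1 makes it a positive real.
          have hc1 : min c 1 ≠ ⊤ := ne_top_of_le_ne_top ENNReal.one_ne_top (min_le_right _ _)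
          have hc0 : min c 1 ≠ 0 := (lt_min (pos_iff_ne_zero.2 hc) one_pos).ne'
          have hcpos := ENNReal.toReal_pos hc0 hc1
          refine ⟨(min c 1).toReal * Real.exp (-(s * S₀)), by positivity, ?_⟩
          filter_upwards [eventually_ge_atTop S₀] with t ht
          refine le_trans ?_ (h (t - S₀) (sub_nonneg.2 ht))
          rw [mul_assoc, ← hshift, ENNReal.ofReal_mul hcpos.le, ENNReal.ofReal_toReal hc1]
          gcongr
          exact min_le_left _ _
    refine key.congr' ?_
    filter_upwards [eventually_ge_atTop S₀] with t ht
    exact (scaledCumulant_eq q₀ l hp₀ hL hR ht).symm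
  · by_contra hlt
    exact lt_asymm h (habove s (not_le.1 hlt))

/-! ### Bounds for the cumulant generating function -/

/-- First-order decay rate in `s` of the Laplace transform of the duration of a cycle. -/
def cycleRate (γ γ' : ℝ) : ℝ := Real.sqrt (Real.pi / 2) * (Real.sqrt γ + Real.sqrt γ')

theorem cycleRate_pos {γ γ' : ℝ} (hγ : 0 < γ) (hγ' : 0 < γ') : 0 < cycleRate γ γ' := by
  have := Real.sqrt_pos.2 hγ
  have := Real.sqrt_pos.2 hγ'
  have := Real.pi_pos
  unfold cycleRate
  positivity

/-- The bound depends only on `γ + γ'`, and `γ_L + γ_R = β_L + β_R` does not involve the tilt; this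
gives uniformity for large `λ`. -/
theorem cycleRate_le {γ γ' : ℝ} (hγ : 0 ≤ γ) (hγ' : 0 ≤ γ') :
    cycleRate γ γ' ≤ Real.sqrt (Real.pi / 2) * Real.sqrt (2 * (γ + γ')) := by
  refine mul_le_mul_of_nonneg_left (Real.le_sqrt_of_sq_le ?_) (Real.sqrt_nonneg _)
  nlinarith [Real.sq_sqrt hγ, Real.sq_sqrt hγ', sq_nonneg (Real.sqrt γ - Real.sqrt γ')]

theorem one_sub_le_mul_gaussLaplace {γ γ' s : ℝ} (hγ : 0 < γ) (hγ' : 0 < γ') (hs : 0 ≤ s) :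
    1 - cycleRate γ γ' * s ≤ gaussLaplace γ s * gaussLaplace γ' s := by
  have h1 := one_sub_le_gaussLaplace hγ hs
  have h2 := one_sub_le_gaussLaplace hγ' hs
  have h3 := gaussLaplace_pos hγ hs
  have h4 := gaussLaplace_pos hγ' hs
  have hx : 0 ≤ Real.sqrt (Real.pi / 2) * Real.sqrt γ * s := by positivity
  have hy : 0 ≤ Real.sqrt (Real.pi / 2) * Real.sqrt γ' * s := by positivity
  have e : cycleRate γ γ' * s = Real.sqrt (Real.pi / 2) * Real.sqrt γ * s +
      Real.sqrt (Real.pi / 2) * Real.sqrt γ' * s := by rw [cycleRate]; ring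
  rw [e]
  set x := Real.sqrt (Real.pi / 2) * Real.sqrt γ * s
  set y := Real.sqrt (Real.pi / 2) * Real.sqrt γ' * s
  rcases le_or_gt (x + y) 1 with h | h
  · have := mul_le_mul h1 h2 (by linarith) h3.le
    nlinarith [mul_nonneg hx hy]
  · nlinarith [mul_pos h3 h4]

/-- Each factor is at most `exp (-u)`, the exponents add up to `w`, and `exp (-w) ≤ 1 / (1 + w)`
leaves no cross terms. -/
theorem mul_gaussLaplace_le {γ γ' s : ℝ} (hγ : 0 < γ) (hγ' : 0 < γ') (hs : 0 ≤ s)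
    (hw : 0 < 1 + (cycleRate γ γ' * s -
      (laplaceError γ + laplaceError γ') * (s * Real.sqrt s))) :
    gaussLaplace γ s * gaussLaplace γ' s ≤ (1 + (cycleRate γ γ' * s -
      (laplaceError γ + laplaceError γ') * (s * Real.sqrt s)))⁻¹ := by
  have key : ∀ {γ : ℝ}, 0 < γ → gaussLaplace γ s ≤ Real.exp
      (-(Real.sqrt (Real.pi / 2) * Real.sqrt γ * s - laplaceError γ * (s * Real.sqrt s))) :=
    fun hγ => by
      refine (gaussLaplace_le hγ hs).trans (le_trans (le_of_eq ?_) (Real.add_one_le_exp _))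
      ring
  have h1 := key hγ
  have h2 := key hγ'
  have h4 := gaussLaplace_pos hγ' hs
  refine (mul_le_mul h1 h2 h4.le (Real.exp_pos _).le).trans ?_
  rw [← Real.exp_add, ← neg_add, Real.exp_neg]
  refine inv_anti₀ hw (le_trans (le_of_eq ?_) (Real.add_one_le_exp _))
  rw [cycleRate]
  ring

theorem cumulantGF_eq_top (q₀ : ℝ) {p₀ βL βR l : ℝ} (hp₀ : p₀ ≠ 0) (hL : 0 < βL)
    (hR : 0 < βR) (h : βL ≤ l ∨ βR ≤ -l) : cumulantGF q₀ p₀ l βL βR = ⊤ :=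
  (tendsto_scaledCumulant_top q₀ hp₀ hL hR h).limsup_eq

/-- The growth criterion with the Laplace transforms replaced by explicit bounds: the lower estimate
has no error term and serves every admissible `l`, while the upper one is a test to be met by a
trial `s`. -/
theorem exists_cumulantGF_eq (q₀ : ℝ) {p₀ βL βR l : ℝ} (hp₀ : p₀ ≠ 0) (hL : 0 < βL)
    (hR : 0 < βR) (hl : l < βL) (hl' : -βR < l) :
    ∃ f : ℝ, cumulantGF q₀ p₀ l βL βR = (f : EReal) ∧ 0 ≤ f ∧
      1 - (βL - l) * (βR + l) / (βL * βR) ≤ cycleRate (βL - l) (βR + l) * f ∧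
      ∀ s, 0 ≤ s → 1 < (1 + (cycleRate (βL - l) (βR + l) * s -
          (laplaceError (βL - l) + laplaceError (βR + l)) * (s * Real.sqrt s))) *
        ((βL - l) * (βR + l) / (βL * βR)) → f ≤ s := by
  have h1 : 0 < βL - l := by linarith
  have h2 : 0 < βR + l := by linarith
  obtain ⟨f, hf0, hlim, hup, hlow⟩ := exists_growthRate q₀ hp₀ hL hR hl hl'
  have hr : 0 < (βL - l) * (βR + l) / (βL * βR) := by positivity
  have hD := cycleRate_pos h1 h2
  set r := (βL - l) * (βR + l) / (βL * βR) with hrdef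
  have hcyc : ∀ s, cycleMass βL βR l s =
      gaussLaplace (βL - l) s * gaussLaplace (βR + l) s / r := fun s => by
    rw [cycleMass, hrdef]
    field_simp
  refine ⟨f, hlim.limsup_eq, hf0, ?_, fun s hs h => hup s hs ?_⟩
  · by_contra hlt
    rw [not_le, mul_comm, ← lt_div_iff₀ hD] at hlt
    obtain ⟨s, hfs, hs⟩ := exists_between hlt
    rw [lt_div_iff₀ hD] at hs
    refine not_le.2 hfs (hlow s (hf0.trans hfs.le) ?_)
    rw [hcyc, one_lt_div hr]
    linarith [one_sub_le_mul_gaussLaplace h1 h2 (hf0.trans hfs.le)]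
  · have hw := pos_of_mul_pos_left (one_pos.trans h) hr.le
    rw [hcyc, div_lt_one hr]
    refine (mul_gaussLaplace_le h1 h2 hs hw).trans_lt ?_
    rwa [inv_lt_iff_one_lt_mul₀' hw]

/-! ### The scaled cumulant generating function -/

/-- Tilted inverse temperature of the left wall. -/
def gammaL (ε l τ T : ℝ) : ℝ := 1 / (T + ε * τ / 2) - ε * l

/-- Tilted inverse temperature of the right wall. -/
def gammaR (ε l τ T : ℝ) : ℝ := 1 / (T - ε * τ / 2) + ε * l

/-- The scaled excess `(1 - β_L⁻¹ β_R⁻¹ γ_L γ_R) / ε²`. -/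
def scaledExcess (ε l τ T : ℝ) : ℝ := l * τ + l ^ 2 * (T ^ 2 - ε ^ 2 * τ ^ 2 / 4)

theorem scaledExcess_eq {ε l τ T : ℝ} (hP : 0 < T + ε * τ / 2) (hR : 0 < T - ε * τ / 2) :
    gammaL ε l τ T * gammaR ε l τ T / (1 / (T + ε * τ / 2) * (1 / (T - ε * τ / 2))) =
      1 - ε ^ 2 * scaledExcess ε l τ T := by
  rw [gammaL, gammaR, scaledExcess]
  have := hP.ne'
  have := hR.ne'
  generalize hP' : T + ε * τ / 2 = P at *
  generalize hR' : T - ε * τ / 2 = R at *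
  have e : ε ^ 2 * (l * τ + l ^ 2 * (T ^ 2 - ε ^ 2 * τ ^ 2 / 4)) =
      ε * l * (P - R) + (ε * l) ^ 2 * (P * R) := by
    rw [← hP', ← hR']; ring
  rw [e]
  field_simp
  ring

/-- With the trial value `s = ε² σ`, the factor `√s = ε √σ` makes the remainder smaller than the
main term by one power of `ε`. -/
theorem exists_calF_eq (q₀ : ℝ) {p₀ ε l τ T : ℝ} (hp₀ : p₀ ≠ 0) (hε : 0 < ε)
    (hP : 0 < T + ε * τ / 2) (hR : 0 < T - ε * τ / 2) (hγ : 0 < gammaL ε l τ T)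
    (hγ' : 0 < gammaR ε l τ T) :
    ∃ F : ℝ, calF q₀ p₀ (ε * l) (ε * τ) T = ((ε ^ 2 * F : ℝ) : EReal) ∧ 0 ≤ F ∧
      scaledExcess ε l τ T ≤ cycleRate (gammaL ε l τ T) (gammaR ε l τ T) * F ∧
      ∀ σ, 0 ≤ σ → scaledExcess ε l τ T <
        (cycleRate (gammaL ε l τ T) (gammaR ε l τ T) * σ -
          (laplaceError (gammaL ε l τ T) + laplaceError (gammaR ε l τ T)) *
            (ε * (σ * Real.sqrt σ))) * (1 - ε ^ 2 * scaledExcess ε l τ T) → F ≤ σ := by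
  obtain ⟨f, hf, hf0, hlow, hup⟩ := exists_cumulantGF_eq q₀ (l := ε * l) hp₀ (one_div_pos.2 hP)
    (one_div_pos.2 hR) (sub_pos.1 hγ) (by
      have : 0 < 1 / (T - ε * τ / 2) + ε * l := hγ'
      linarith)
  change 1 - gammaL ε l τ T * gammaR ε l τ T / (1 / (T + ε * τ / 2) * (1 / (T - ε * τ / 2))) ≤
    cycleRate (gammaL ε l τ T) (gammaR ε l τ T) * f at hlow
  change ∀ s, 0 ≤ s → 1 < (1 + (cycleRate (gammaL ε l τ T) (gammaR ε l τ T) * s -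
    (laplaceError (gammaL ε l τ T) + laplaceError (gammaR ε l τ T)) * (s * Real.sqrt s))) *
    (gammaL ε l τ T * gammaR ε l τ T / (1 / (T + ε * τ / 2) * (1 / (T - ε * τ / 2)))) → f ≤ s at hup
  rw [scaledExcess_eq hP hR] at hlow hup
  have hε2 : 0 < ε ^ 2 := by positivity
  have hfε : ε ^ 2 * (f / ε ^ 2) = f := by field_simp
  refine ⟨f / ε ^ 2, ?_, by positivity, ?_, fun σ hσ h => ?_⟩
  · rw [hfε]; exact hf
  · refine le_of_mul_le_mul_left ?_ hε2
    rw [mul_left_comm, hfε]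
    linarith
  · rw [div_le_iff₀ hε2, mul_comm]
    refine hup _ (by positivity) ?_
    rw [Real.sqrt_mul hε2.le, Real.sqrt_sq hε.le]
    have := mul_lt_mul_of_pos_left h hε2
    nlinarith

theorem calF_eq_top (q₀ : ℝ) {p₀ ε l τ T : ℝ} (hp₀ : p₀ ≠ 0)
    (hP : 0 < T + ε * τ / 2) (hR : 0 < T - ε * τ / 2)
    (h : gammaL ε l τ T ≤ 0 ∨ gammaR ε l τ T ≤ 0) :
    calF q₀ p₀ (ε * l) (ε * τ) T = ⊤ := by
  refine cumulantGF_eq_top q₀ hp₀ (one_div_pos.2 hP) (one_div_pos.2 hR) ?_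
  rw [gammaL, gammaR] at h
  rcases h with h | h
  · left; linarith
  · right; linarith

theorem kappa_pos {T : ℝ} (hT : 0 < T) : 0 < kappa T :=
  Real.sqrt_pos.2 (div_pos hT (by positivity))

theorem continuous_kappa : Continuous kappa := by
  unfold kappa
  fun_prop

/-- Both quadratic branches are the same polynomial, written in `l` and in the reflected variable
`-(l + τ / T²)`; the middle branch is where it is nonpositive. -/
theorem calH_eq {T : ℝ} (l τ : ℝ) (hT : 0 < T) :
    calH l τ T = kappa T * max 0 (l * τ + l ^ 2 * T ^ 2) := by
  have hκ := kappa_pos hT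
  have hT2 : 0 < T ^ 2 := by positivity
  unfold calH
  split_ifs with h1 h2 h3
  · rw [h1, max_eq_right (by nlinarith [mul_nonneg (sq_nonneg l) hT2.le])]
    ring
  · rw [max_eq_right (by positivity)]
    ring
  · have h4 : l * τ ≤ 0 := not_lt.1 h2
    have h5 : l * τ * (l * τ + τ ^ 2 / T ^ 2) ≤ 0 :=
      mul_nonpos_of_nonpos_of_nonneg h4 (by linarith)
    have h6 : 0 < τ ^ 2 := by positivity
    have h7 : l * τ * (l * τ + τ ^ 2 / T ^ 2) = τ ^ 2 / T ^ 2 * (l * τ + l ^ 2 * T ^ 2) := by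
      field_simp
      ring
    rw [h7] at h5
    rw [max_eq_left (nonpos_of_mul_nonpos_right h5 (by positivity)), mul_zero]
  · have h4 : l * τ < 0 := by
      have : 0 < τ ^ 2 / T ^ 2 := by positivity
      linarith
    have h5 : 0 ≤ l * τ * (l * τ + τ ^ 2 / T ^ 2) :=
      mul_nonneg_of_nonpos_of_nonpos h4.le (by linarith)
    have h7 : l * τ * (l * τ + τ ^ 2 / T ^ 2) = τ ^ 2 / T ^ 2 * (l * τ + l ^ 2 * T ^ 2) := by
      field_simp
      ring
    rw [h7] at h5
    rw [max_eq_right (nonneg_of_mul_nonneg_right h5 (by positivity))]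
    field_simp
    ring

theorem cycleRate_mul_kappa {T : ℝ} (hT : 0 < T) : cycleRate (1 / T) (1 / T) * kappa T = 1 := by
  have h := Real.pi_pos
  rw [cycleRate, kappa, ← two_mul, mul_left_comm, mul_assoc, mul_assoc,
    ← Real.sqrt_mul (by positivity), ← Real.sqrt_mul (by positivity),
    show Real.pi / 2 * (1 / T * (T / (2 * Real.pi))) = (1 / 2) ^ 2 by field_simp,
    Real.sqrt_sq (by norm_num)]
  norm_num

/-! ### Uniform convergence of the scaled cumulant generating function -/

theorem continuousAt_laplaceError {γ : ℝ} (hγ : 0 < γ) : ContinuousAt laplaceError γ := by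
  unfold laplaceError
  refine continuousAt_id.mul (ContinuousAt.mul (ContinuousAt.mul ?_ continuousAt_const)
    continuousAt_const)
  exact ContinuousAt.rpow_const (by fun_prop) (Or.inl (half_pos hγ).ne')

/-- Both bounds on `F` come from strict inequalities that hold at `ε = 0` between functions
continuous in all four variables, so they persist nearby. -/
theorem eventually_calF_near (q₀ : ℝ) {p₀ : ℝ} (hp₀ : p₀ ≠ 0) {x : ℝ × ℝ × ℝ} (hx : 0 < x.2.2)
    {δ : ℝ} (hδ : 0 < δ) :
    ∀ᶠ z : ℝ × ℝ × ℝ × ℝ in 𝓝 ((0 : ℝ), x), 0 < z.1 →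
      ∃ F : ℝ, calF q₀ p₀ (z.1 * z.2.1) (z.1 * z.2.2.1) z.2.2.2 = ((z.1 ^ 2 * F : ℝ) : EReal) ∧
        calH z.2.1 z.2.2.1 z.2.2.2 - δ < F ∧ F < calH z.2.1 z.2.2.1 z.2.2.2 + δ := by
  obtain ⟨l, τ, T⟩ := x
  replace hx : 0 < T := hx
  set x₀ : ℝ × ℝ × ℝ × ℝ := (0, l, τ, T) with hx₀
  let H : ℝ × ℝ × ℝ × ℝ → ℝ := fun z =>
    kappa z.2.2.2 * max 0 (z.2.1 * z.2.2.1 + z.2.1 ^ 2 * z.2.2.2 ^ 2)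
  let q : ℝ × ℝ × ℝ × ℝ → ℝ := fun z => scaledExcess z.1 z.2.1 z.2.2.1 z.2.2.2
  let g : ℝ × ℝ × ℝ × ℝ → ℝ := fun z => gammaL z.1 z.2.1 z.2.2.1 z.2.2.2
  let g' : ℝ × ℝ × ℝ × ℝ → ℝ := fun z => gammaR z.1 z.2.1 z.2.2.1 z.2.2.2
  have hH : ContinuousAt H x₀ :=
    (Continuous.mul (continuous_kappa.comp (by fun_prop)) (by fun_prop)).continuousAt
  have hq : ContinuousAt q x₀ := by
    simp only [q, scaledExcess]; fun_prop
  have hP : ContinuousAt (fun z : ℝ × ℝ × ℝ × ℝ => z.2.2.2 + z.1 * z.2.2.1 / 2) x₀ := by fun_prop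
  have hR : ContinuousAt (fun z : ℝ × ℝ × ℝ × ℝ => z.2.2.2 - z.1 * z.2.2.1 / 2) x₀ := by fun_prop
  have hg : ContinuousAt g x₀ := by
    simp only [g, gammaL]
    exact (continuousAt_const.div hP (by simpa [x₀] using hx.ne')).sub (by fun_prop)
  have hg' : ContinuousAt g' x₀ := by
    simp only [g', gammaR]
    exact (continuousAt_const.div hR (by simpa [x₀] using hx.ne')).add (by fun_prop)
  have hg0 : g x₀ = 1 / T := by simp [g, gammaL, x₀]
  have hg0' : g' x₀ = 1 / T := by simp [g', gammaR, x₀]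
  have hT : 0 < 1 / T := one_div_pos.2 hx
  have hD : ContinuousAt (fun z => cycleRate (g z) (g' z)) x₀ := by
    simp only [cycleRate]
    exact continuousAt_const.mul (hg.sqrt.add hg'.sqrt)
  have hE : ContinuousAt (fun z => laplaceError (g z) + laplaceError (g' z)) x₀ :=
    (ContinuousAt.comp (f := g) (hg0 ▸ continuousAt_laplaceError hT) hg).add
      (ContinuousAt.comp (f := g') (hg0' ▸ continuousAt_laplaceError hT) hg')
  have hDκ := cycleRate_mul_kappa hx
  have hD0 : 0 < cycleRate (1 / T) (1 / T) := cycleRate_pos hT hT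
  have hqx : q x₀ = l * τ + l ^ 2 * T ^ 2 := by simp [q, scaledExcess, x₀]
  have hHx : H x₀ = kappa T * max 0 (q x₀) := by rw [hqx]
  have hlow : ∀ᶠ z in 𝓝 x₀, H z - δ < max 0 (q z / cycleRate (g z) (g' z)) := by
    have hc : ContinuousAt (fun z => max 0 (q z / cycleRate (g z) (g' z))) x₀ :=
      ContinuousAt.sup continuousAt_const (hq.div hD (by rw [hg0, hg0']; exact hD0.ne'))
    refine (hH.sub continuousAt_const).eventually_lt hc ?_
    have : max 0 (q x₀ / cycleRate (g x₀) (g' x₀)) = H x₀ := by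
      rw [hg0, hg0', hHx, eq_div_of_mul_eq hD0.ne' ((mul_comm _ _).trans hDκ),
        div_mul_eq_mul_div, one_mul]
      rw [← max_div_div_right hD0.le, zero_div]
    rw [this]
    exact sub_lt_self _ hδ
  -- The trial value is `σ = H + δ / 2`; at `ε = 0` the error disappears and the gap is at least
  -- `cycleRate * δ / 2`.
  have hup : ∀ᶠ z in 𝓝 x₀, q z < (cycleRate (g z) (g' z) * (H z + δ / 2) -
      (laplaceError (g z) + laplaceError (g' z)) *
        (z.1 * ((H z + δ / 2) * Real.sqrt (H z + δ / 2)))) * (1 - z.1 ^ 2 * q z) := by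
    have hσ : ContinuousAt (fun z => H z + δ / 2) x₀ := hH.add continuousAt_const
    have h1 : ContinuousAt (fun z : ℝ × ℝ × ℝ × ℝ => z.1) x₀ := continuousAt_fst
    refine hq.eventually_lt (((hD.mul hσ).sub (hE.mul (h1.mul (hσ.mul hσ.sqrt)))).mul
      (continuousAt_const.sub ((h1.pow 2).mul hq))) ?_
    have h2 : q x₀ ≤ max 0 (q x₀) := le_max_right _ _
    have h3 : cycleRate (1 / T) (1 / T) * (H x₀ + δ / 2) =
        max 0 (q x₀) + cycleRate (1 / T) (1 / T) * (δ / 2) := by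
      rw [hHx, mul_add, ← mul_assoc, hDκ, one_mul]
    have h4 : 0 < cycleRate (1 / T) (1 / T) * (δ / 2) := by positivity
    have h5 : x₀.1 = 0 := rfl
    simp only [hg0, hg0', h3, h5]
    rw [zero_mul, mul_zero, sub_zero, zero_pow two_ne_zero, zero_mul, sub_zero, mul_one]
    linarith
  have hposP := continuousAt_const.eventually_lt hP (by simpa [x₀] using hx : (0 : ℝ) < _)
  have hposR := continuousAt_const.eventually_lt hR (by simpa [x₀] using hx : (0 : ℝ) < _)
  have hposg := continuousAt_const.eventually_lt hg (by rw [hg0]; exact hT : (0 : ℝ) < _)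
  have hposg' := continuousAt_const.eventually_lt hg' (by rw [hg0']; exact hT : (0 : ℝ) < _)
  filter_upwards [hlow, hup, hposP, hposR, hposg, hposg'] with z h1 h2 h3 h4 h5 h6 hz
  have hTz : 0 < z.2.2.2 := by linarith
  obtain ⟨F, hF, hF0, hFl, hFu⟩ := exists_calF_eq q₀ (l := z.2.1) hp₀ hz h3 h4 h5 h6
  have hDz := cycleRate_pos h5 h6
  have hHz : calH z.2.1 z.2.2.1 z.2.2.2 = H z := calH_eq _ _ hTz
  have hH0 : 0 ≤ H z := mul_nonneg (kappa_pos hTz).le (le_max_left _ _)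
  refine ⟨F, hF, ?_, ?_⟩
  · rw [hHz]
    refine h1.trans_le (max_le hF0 ?_)
    rw [div_le_iff₀ hDz, mul_comm]
    exact hFl
  · rw [hHz]
    have := hFu (H z + δ / 2) (by positivity) h2
    linarith

theorem eventually_calF_uniform (q₀ : ℝ) {p₀ : ℝ} (hp₀ : p₀ ≠ 0) {K : Set (ℝ × ℝ × ℝ)}
    (hK : IsCompact K) (hpos : ∀ x ∈ K, 0 < x.2.2) {δ : ℝ} (hδ : 0 < δ) :
    ∀ᶠ ε : ℝ in 𝓝[>] 0, ∀ l τ T : ℝ, (l, τ, T) ∈ K →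
      ∃ F : ℝ, calF q₀ p₀ (ε * l) (ε * τ) T = ((ε ^ 2 * F : ℝ) : EReal) ∧
        calH l τ T - δ < F ∧ F < calH l τ T + δ := by
  have h := hK.eventually_forall_of_forall_eventually (x₀ := (0 : ℝ))
    (P := fun ε x => 0 < ε → ∃ F : ℝ,
      calF q₀ p₀ (ε * x.1) (ε * x.2.1) x.2.2 = ((ε ^ 2 * F : ℝ) : EReal) ∧
        calH x.1 x.2.1 x.2.2 - δ < F ∧ F < calH x.1 x.2.1 x.2.2 + δ)
    fun x hx => eventually_calF_near q₀ hp₀ (hpos x hx) hδ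
  filter_upwards [nhdsWithin_le_nhds h, self_mem_nhdsWithin] with ε hε hε0 l τ T hm
  exact hε (l, τ, T) hm hε0

/-! ### The Legendre transform of the limit -/

/-- For `a ∈ [0, 1]`, `a Q ≤ max 0 Q`. Taking `a = 1` and completing the square settles the outer
branches; in the middle ones `a` is the slope fraction that makes `j` a subgradient at one of the
two corners. -/
theorem mul_sub_calH_le {T : ℝ} (hT : 0 < T) (j τ l : ℝ) : l * j - calH l τ T ≤ calG j τ T := by
  have hk := kappa_pos hT
  rw [calH_eq l τ hT]
  set k := kappa T with hkdef
  have hT2 : 0 < T ^ 2 := by positivity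
  have hle : ∀ a : ℝ, 0 ≤ a → a ≤ 1 → a * (k * (l * τ + l ^ 2 * T ^ 2)) ≤
      k * max 0 (l * τ + l ^ 2 * T ^ 2) := fun a h0 h1 => by
    have h2 := le_max_right 0 (l * τ + l ^ 2 * T ^ 2)
    have h3 := le_max_left 0 (l * τ + l ^ 2 * T ^ 2)
    calc a * (k * (l * τ + l ^ 2 * T ^ 2)) = k * (a * (l * τ + l ^ 2 * T ^ 2)) := by ring
      _ ≤ k * (a * max 0 (l * τ + l ^ 2 * T ^ 2)) := by gcongr
      _ ≤ k * max 0 (l * τ + l ^ 2 * T ^ 2) := by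
        gcongr; exact mul_le_of_le_one_left h3 h1
  have hquad : l * j - k * max 0 (l * τ + l ^ 2 * T ^ 2) ≤ (j - k * τ) ^ 2 / (4 * k * T ^ 2) := by
    have h1 := hle 1 zero_le_one le_rfl
    have h2 : l * j - k * (l * τ + l ^ 2 * T ^ 2) ≤ (j - k * τ) ^ 2 / (4 * k * T ^ 2) := by
      rw [le_div_iff₀ (by positivity)]
      nlinarith [sq_nonneg (j - k * τ - 2 * k * l * T ^ 2)]
    linarith
  unfold calG
  rw [← hkdef]
  split_ifs with h1 h2 h3 h4
  · simpa [h1] using hquad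
  · exact hquad
  · have hτ : 0 < τ ^ 2 := by positivity
    have h5 := hle (j * τ / (k * τ ^ 2)) (by positivity)
      (by rw [div_le_one (by positivity)]; exact not_lt.1 h2)
    have h6 : j * τ / (k * τ ^ 2) * (k * (l * τ + l ^ 2 * T ^ 2)) =
        l * j + j * τ * (l * T / τ) ^ 2 := by
      field_simp
    have h7 : 0 ≤ j * τ * (l * T / τ) ^ 2 := mul_nonneg h3 (sq_nonneg _)
    linarith
  · have hτ : 0 < τ ^ 2 := by positivity
    have hjτ : 0 < -(j * τ) := neg_pos.2 (not_le.1 h3)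
    -- This weight gives the scaled parabola slope `j` at its other zero `-τ / T²`, leaving a
    -- perfect square.
    have h5 := hle (-(j * τ) / (k * τ ^ 2)) (by positivity)
      (by rw [div_le_one (by positivity)]; linarith)
    have h6 : -(j * τ) / (k * τ ^ 2) * (k * (l * τ + l ^ 2 * T ^ 2)) =
        l * j - -(j * τ) / T ^ 2 + -(j * τ) * ((l * T ^ 2 + τ) / (τ * T)) ^ 2 := by
      field_simp
      ring
    have h7 : 0 ≤ -(j * τ) * ((l * T ^ 2 + τ) / (τ * T)) ^ 2 := mul_nonneg hjτ.le (sq_nonneg _)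
    linarith
  · exact hquad

/-- The maximiser is the vertex of the parabola or one of the corners `0`, `-τ / T²`. The bound on
`|l|` confines it to a fixed interval for parameters in a compact set. -/
theorem exists_mul_sub_calH_eq {T : ℝ} (hT : 0 < T) (j τ : ℝ) :
    ∃ l : ℝ, l * j - calH l τ T = calG j τ T ∧
      |l| ≤ |(j - kappa T * τ) / (2 * kappa T * T ^ 2)| + |τ / T ^ 2| := by
  have hk := kappa_pos hT
  simp_rw [calH_eq _ τ hT]
  set k := kappa T with hkdef
  have hT2 : 0 < T ^ 2 := by positivity
  have hquad : k ^ 2 * τ ^ 2 ≤ j ^ 2 → ∃ l : ℝ,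
      l * j - k * max 0 (l * τ + l ^ 2 * T ^ 2) = (j - k * τ) ^ 2 / (4 * k * T ^ 2) ∧
        |l| ≤ |(j - k * τ) / (2 * k * T ^ 2)| + |τ / T ^ 2| := by
    intro h
    refine ⟨(j - k * τ) / (2 * k * T ^ 2), ?_, le_add_of_nonneg_right (abs_nonneg _)⟩
    have h1 : (j - k * τ) / (2 * k * T ^ 2) * τ + ((j - k * τ) / (2 * k * T ^ 2)) ^ 2 * T ^ 2 =
        (j ^ 2 - k ^ 2 * τ ^ 2) / (4 * k ^ 2 * T ^ 2) := by
      field_simp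
      ring
    rw [h1, max_eq_right (div_nonneg (sub_nonneg.2 h) (by positivity))]
    field_simp
    ring
  unfold calG
  rw [← hkdef]
  split_ifs with h1 h2 h3 h4
  · simpa [h1] using hquad (by rw [h1]; nlinarith [sq_nonneg j])
  · have hτ : 0 < τ ^ 2 := by positivity
    refine hquad (le_of_mul_le_mul_right ?_ hτ)
    nlinarith [mul_pos hk hτ]
  · exact ⟨0, by simp, by simpa using by positivity⟩
  · refine ⟨-(τ / T ^ 2), ?_, ?_⟩
    · have : -(τ / T ^ 2) * τ + (-(τ / T ^ 2)) ^ 2 * T ^ 2 = 0 := by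
        field_simp
        ring
      rw [this, max_self, mul_zero, sub_zero]
      ring
    · rw [abs_neg]
      exact le_add_of_nonneg_left (abs_nonneg _)
  · have hτ : 0 < τ ^ 2 := by positivity
    refine hquad (le_of_mul_le_mul_right ?_ hτ)
    nlinarith [mul_pos hk hτ]

theorem calG_nonneg {T : ℝ} (hT : 0 < T) (j τ : ℝ) : 0 ≤ calG j τ T := by
  have h := mul_sub_calH_le hT j τ 0
  rw [calH_eq 0 τ hT] at h
  simpa using h

/-! ### Uniform convergence of the scaled Legendre transform -/

/-- The excess grows quadratically in `l` while `cycleRate` is bounded independently of `l`, and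
beyond the domain the value is `⊤`. Convergence on compacts says nothing about such large `l`. -/
theorem exists_linear_lower_bound (q₀ : ℝ) {p₀ : ℝ} (hp₀ : p₀ ≠ 0) {B T₀ : ℝ}
    (hT₀ : 0 < T₀) : ∃ R : ℝ, ∀ᶠ ε : ℝ in 𝓝[>] 0, ∀ l τ T : ℝ, |τ| ≤ B → T₀ ≤ T → R ≤ |l| →
      ((ε ^ 2 * (|l| * B) : ℝ) : EReal) ≤ calF q₀ p₀ (ε * l) (ε * τ) T := by
  set D₀ := Real.sqrt (Real.pi / 2) * Real.sqrt (8 / T₀) with hD₀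
  have hD₀' : 0 < D₀ := by have := Real.pi_pos; positivity
  -- From this threshold on, `|l| * T₀² / 2 - B ≥ D₀ * B`.
  refine ⟨2 * (B + D₀ * B) / T₀ ^ 2, ?_⟩
  have hlim : Tendsto (fun ε : ℝ => ε * B) (𝓝[>] 0) (𝓝 0) :=
    tendsto_nhdsWithin_of_tendsto_nhds (by simpa using (continuous_mul_const B).tendsto 0)
  filter_upwards [hlim.eventually_lt_const hT₀, self_mem_nhdsWithin] with ε hεB hε l τ T hτ hT hl
  replace hε : 0 < ε := hε
  have hT0 : 0 < T := hT₀.trans_le hT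
  have hετ : |ε * τ| ≤ T := by
    rw [abs_mul, abs_of_pos hε]
    exact (mul_le_mul_of_nonneg_left hτ hε.le).trans (hεB.le.trans hT)
  obtain ⟨h1, h2⟩ := abs_le.1 hετ
  have hP : 0 < T + ε * τ / 2 := by linarith
  have hR : 0 < T - ε * τ / 2 := by linarith
  by_cases hγ : gammaL ε l τ T ≤ 0 ∨ gammaR ε l τ T ≤ 0
  · rw [calF_eq_top q₀ hp₀ hP hR hγ]
    exact le_top
  rw [not_or, not_le, not_le] at hγ
  obtain ⟨F, hF, hF0, hFl, -⟩ := exists_calF_eq q₀ hp₀ hε hP hR hγ.1 hγ.2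
  rw [hF, EReal.coe_le_coe_iff]
  refine mul_le_mul_of_nonneg_left ?_ (sq_nonneg ε)
  have hsq : ε ^ 2 * τ ^ 2 ≤ T ^ 2 := by
    rw [← mul_pow]; exact sq_le_sq' h1 h2
  have hD : cycleRate (gammaL ε l τ T) (gammaR ε l τ T) ≤ D₀ := by
    refine (cycleRate_le hγ.1.le hγ.2.le).trans (mul_le_mul_of_nonneg_left
      (Real.sqrt_le_sqrt ?_) (Real.sqrt_nonneg _))
    have e : 2 * (gammaL ε l τ T + gammaR ε l τ T) = 4 * T / (T ^ 2 - ε ^ 2 * τ ^ 2 / 4) := by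
      have : T ^ 2 - ε ^ 2 * τ ^ 2 / 4 = (T + ε * τ / 2) * (T - ε * τ / 2) := by ring
      rw [gammaL, gammaR, this, sub_add_add_cancel, div_add_div _ _ hP.ne' hR.ne']
      ring
    have h3 : T ^ 2 / 2 ≤ T ^ 2 - ε ^ 2 * τ ^ 2 / 4 := by nlinarith [sq_nonneg T]
    calc 2 * (gammaL ε l τ T + gammaR ε l τ T) = 4 * T / (T ^ 2 - ε ^ 2 * τ ^ 2 / 4) := e
      _ ≤ 4 * T / (T ^ 2 / 2) := by gcongr
      _ = 8 / T := by field_simp; norm_num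
      _ ≤ 8 / T₀ := by gcongr
  have hq : |l| * (|l| * (T₀ ^ 2 / 2) - B) ≤ scaledExcess ε l τ T := by
    have h3 : -(|l| * B) ≤ l * τ := by
      have h4 := neg_abs_le (l * τ)
      rw [abs_mul] at h4
      have h5 := mul_le_mul_of_nonneg_left hτ (abs_nonneg l)
      linarith
    have h4 : l ^ 2 * (T₀ ^ 2 / 2) ≤ l ^ 2 * (T ^ 2 - ε ^ 2 * τ ^ 2 / 4) := by
      refine mul_le_mul_of_nonneg_left ?_ (sq_nonneg l)
      nlinarith [pow_le_pow_left₀ hT₀.le hT 2, sq_nonneg T]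
    rw [scaledExcess]
    nlinarith [sq_abs l]
  rw [div_le_iff₀ (by positivity)] at hl
  have h5 : |l| * (D₀ * B) ≤ |l| * (|l| * (T₀ ^ 2 / 2) - B) :=
    mul_le_mul_of_nonneg_left (by linarith) (abs_nonneg l)
  have h6 := mul_le_mul_of_nonneg_right hD hF0
  refine le_of_mul_le_mul_left ?_ hD₀'
  linarith

/-- The supremum is rescaled by `l' = ε l` and split at `|l| = R'`: inside, `calF` is uniformly
close to `calH`; outside, the terms are at most `0 ≤ calG`. -/
theorem eventually_calI_uniform (q₀ : ℝ) {p₀ : ℝ} (hp₀ : p₀ ≠ 0) {K : Set (ℝ × ℝ × ℝ)}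
    (hK : IsCompact K) (hpos : ∀ x ∈ K, 0 < x.2.2) {δ : ℝ} (hδ : 0 < δ) :
    ∀ᶠ ε : ℝ in 𝓝[>] 0, ∀ j τ T : ℝ, (j, τ, T) ∈ K →
      ((ε ^ 2 * (calG j τ T - δ) : ℝ) : EReal) ≤ calI q₀ p₀ (ε * j) (ε * τ) T ∧
        calI q₀ p₀ (ε * j) (ε * τ) T ≤ ((ε ^ 2 * (calG j τ T + δ) : ℝ) : EReal) := by
  obtain ⟨C₁, hC₁⟩ := hK.exists_bound_of_continuousOn (f := fun x => x.1)
    continuous_fst.continuousOn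
  obtain ⟨C₂, hC₂⟩ := hK.exists_bound_of_continuousOn (f := fun x => x.2.1)
    (by fun_prop)
  obtain ⟨C₃, hC₃⟩ := hK.exists_bound_of_continuousOn (f := fun x => 1 / x.2.2)
    (continuousOn_const.div (by fun_prop) fun x hx => (hpos x hx).ne')
  obtain ⟨C₄, hC₄⟩ := hK.exists_bound_of_continuousOn
    (f := fun x => |(x.1 - kappa x.2.2 * x.2.1) / (2 * kappa x.2.2 * x.2.2 ^ 2)| +
      |x.2.1 / x.2.2 ^ 2|) (by
    have hκ : ContinuousOn (fun x : ℝ × ℝ × ℝ => kappa x.2.2) K :=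
      (continuous_kappa.comp (by fun_prop)).continuousOn
    refine ContinuousOn.add (ContinuousOn.abs (ContinuousOn.div ?_ ?_ fun x hx => ?_))
      (ContinuousOn.abs (ContinuousOn.div (by fun_prop) (by fun_prop) fun x hx => ?_))
    · exact continuous_fst.continuousOn.sub (hκ.mul (by fun_prop))
    · exact (continuousOn_const.mul hκ).mul (by fun_prop)
    · have := hpos x hx
      have := kappa_pos this
      positivity
    · have := hpos x hx
      positivity)
  set B := max (max C₁ C₂) 0 with hB
  set T₀ := 1 / (max C₃ 0 + 1) with hT₀
  have hT₀pos : 0 < T₀ := by positivity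
  obtain ⟨R, hR⟩ := exists_linear_lower_bound q₀ hp₀ (B := B) hT₀pos
  -- Large enough for the linear bound beyond it and for the limiting maximisers within it.
  set R' := max R C₄ with hR'
  have hK' : IsCompact (Set.Icc (-R') R' ×ˢ (Prod.snd '' K)) :=
    isCompact_Icc.prod (hK.image continuous_snd)
  have hpos' : ∀ x ∈ Set.Icc (-R') R' ×ˢ (Prod.snd '' K), 0 < x.2.2 := by
    rintro ⟨l, y⟩ ⟨-, x, hx, rfl⟩
    exact hpos x hx
  filter_upwards [hR, eventually_calF_uniform q₀ hp₀ hK' hpos' hδ, self_mem_nhdsWithin]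
    with ε hεR hεF hε j τ T hm
  replace hε : 0 < ε := hε
  have hT : 0 < T := hpos _ hm
  have hj : |j| ≤ B := (hC₁ _ hm).trans ((le_max_left _ _).trans (le_max_left _ _))
  have hτ : |τ| ≤ B := (hC₂ _ hm).trans ((le_max_right _ _).trans (le_max_left _ _))
  have hTT : T₀ ≤ T := by
    have h1 := (le_abs_self _).trans (hC₃ _ hm)
    rw [hT₀, one_div_le (by positivity) hT]
    have := le_max_left C₃ 0
    simp only at h1
    linarith
  have hmem : ∀ l, |l| ≤ R' → (l, τ, T) ∈ Set.Icc (-R') R' ×ˢ (Prod.snd '' K) := fun l hl =>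
    ⟨abs_le.1 hl, (j, τ, T), hm, rfl⟩
  constructor
  · obtain ⟨l, hl, hl'⟩ := exists_mul_sub_calH_eq hT j τ
    have hlR : |l| ≤ R' := (hl'.trans ((le_abs_self _).trans (hC₄ _ hm))).trans (le_max_right _ _)
    obtain ⟨F, hF, -, hF'⟩ := hεF l τ T (hmem l hlR)
    refine le_trans ?_ (le_iSup (fun l : ℝ => (((l * (ε * j) : ℝ) : EReal) -
      calF q₀ p₀ l (ε * τ) T)) (ε * l))
    rw [hF, ← EReal.coe_sub, EReal.coe_le_coe_iff]
    have : calG j τ T - δ ≤ l * j - F := by linarith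
    nlinarith [mul_le_mul_of_nonneg_left this (sq_nonneg ε)]
  · refine iSup_le fun l' => ?_
    obtain ⟨l, rfl⟩ : ∃ l, l' = ε * l := ⟨l' / ε, by field_simp⟩
    have hG := calG_nonneg hT j τ
    rcases le_or_gt |l| R' with hlR | hlR
    · obtain ⟨F, hF, hF', -⟩ := hεF l τ T (hmem l hlR)
      rw [hF, ← EReal.coe_sub, EReal.coe_le_coe_iff]
      have h1 := mul_sub_calH_le hT j τ l
      have : l * j - F ≤ calG j τ T + δ := by linarith
      nlinarith [mul_le_mul_of_nonneg_left this (sq_nonneg ε)]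
    · have h1 := hεR l τ T hτ hTT ((le_max_left _ _).trans hlR.le)
      refine (EReal.sub_le_sub le_rfl h1).trans ?_
      rw [← EReal.coe_sub, EReal.coe_le_coe_iff]
      have h2 : l * j ≤ |l| * B := by
        refine (le_abs_self _).trans ?_
        rw [abs_mul]
        exact mul_le_mul_of_nonneg_left hj (abs_nonneg l)
      have h3 := mul_le_mul_of_nonneg_left h2 (sq_nonneg ε)
      have h4 : 0 ≤ ε ^ 2 * (calG j τ T + δ) := by positivity
      linarith

/-! ### Limits after division by `ε ^ 2` -/

theorem one_div_sq_mul_coe {ε : ℝ} (hε : 0 < ε) (x : ℝ) :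
    ((1 / ε ^ 2 : ℝ) : EReal) * ((ε ^ 2 * x : ℝ) : EReal) = (x : EReal) := by
  rw [← EReal.coe_mul]
  congr 1
  field_simp

theorem eventually_mul_calF_uniform (q₀ : ℝ) {p₀ : ℝ} (hp₀ : p₀ ≠ 0) {K : Set (ℝ × ℝ × ℝ)}
    (hK : IsCompact K) (hpos : ∀ x ∈ K, 0 < x.2.2) {δ : ℝ} (hδ : 0 < δ) :
    ∀ᶠ ε : ℝ in 𝓝[>] 0, ∀ l τ T : ℝ, (l, τ, T) ∈ K →
      ((calH l τ T - δ : ℝ) : EReal) <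
          ((1 / ε ^ 2 : ℝ) : EReal) * calF q₀ p₀ (ε * l) (ε * τ) T ∧
        ((1 / ε ^ 2 : ℝ) : EReal) * calF q₀ p₀ (ε * l) (ε * τ) T <
          ((calH l τ T + δ : ℝ) : EReal) := by
  filter_upwards [eventually_calF_uniform q₀ hp₀ hK hpos hδ, self_mem_nhdsWithin]
    with ε h hε l τ T hm
  obtain ⟨F, hF, h1, h2⟩ := h l τ T hm
  rw [hF, one_div_sq_mul_coe hε]
  exact ⟨EReal.coe_lt_coe_iff.2 h1, EReal.coe_lt_coe_iff.2 h2⟩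

theorem eventually_mul_calI_uniform (q₀ : ℝ) {p₀ : ℝ} (hp₀ : p₀ ≠ 0) {K : Set (ℝ × ℝ × ℝ)}
    (hK : IsCompact K) (hpos : ∀ x ∈ K, 0 < x.2.2) {δ : ℝ} (hδ : 0 < δ) :
    ∀ᶠ ε : ℝ in 𝓝[>] 0, ∀ j τ T : ℝ, (j, τ, T) ∈ K →
      ((calG j τ T - δ : ℝ) : EReal) <
          ((1 / ε ^ 2 : ℝ) : EReal) * calI q₀ p₀ (ε * j) (ε * τ) T ∧
        ((1 / ε ^ 2 : ℝ) : EReal) * calI q₀ p₀ (ε * j) (ε * τ) T <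
          ((calG j τ T + δ : ℝ) : EReal) := by
  filter_upwards [eventually_calI_uniform q₀ hp₀ hK hpos (half_pos hδ), self_mem_nhdsWithin]
    with ε h hε j τ T hm
  replace hε : 0 < ε := hε
  obtain ⟨h1, h2⟩ := h j τ T hm
  have h0 : (0 : EReal) ≤ ((1 / ε ^ 2 : ℝ) : EReal) := EReal.coe_nonneg.2 (by positivity)
  have h3 := mul_le_mul_of_nonneg_left h1 h0
  have h4 := mul_le_mul_of_nonneg_left h2 h0
  rw [one_div_sq_mul_coe hε] at h3 h4
  exact ⟨(EReal.coe_lt_coe_iff.2 (by linarith)).trans_le h3,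
    h4.trans_lt (EReal.coe_lt_coe_iff.2 (by linarith))⟩

theorem tendsto_coe_of_eventually_between {u : ℝ → EReal} {a : ℝ} {F : Filter ℝ}
    (h : ∀ δ : ℝ, 0 < δ → ∀ᶠ ε in F, ((a - δ : ℝ) : EReal) < u ε ∧ u ε < ((a + δ : ℝ) : EReal)) :
    Tendsto u F (𝓝 (a : EReal)) := by
  refine tendsto_order.2 ⟨fun b hb => ?_, fun b hb => ?_⟩
  · obtain ⟨x, hx, hxa⟩ := EReal.lt_iff_exists_real_btwn.1 hb
    filter_upwards [h (a - x) (sub_pos.2 (EReal.coe_lt_coe_iff.1 hxa))] with ε hε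
    rw [sub_sub_cancel] at hε
    exact hx.trans hε.1
  · obtain ⟨x, hxa, hx⟩ := EReal.lt_iff_exists_real_btwn.1 hb
    filter_upwards [h (x - a) (sub_pos.2 (EReal.coe_lt_coe_iff.1 hxa))] with ε hε
    rw [add_sub_cancel] at hε
    exact hε.2.trans hx

theorem tendsto_mul_calF (q₀ : ℝ) {p₀ : ℝ} (hp₀ : p₀ ≠ 0) {T : ℝ} (hT : 0 < T) (l τ : ℝ) :
    Tendsto (fun ε : ℝ => ((1 / ε ^ 2 : ℝ) : EReal) * calF q₀ p₀ (ε * l) (ε * τ) T)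
      (𝓝[>] 0) (𝓝 ((calH l τ T : ℝ) : EReal)) := by
  refine tendsto_coe_of_eventually_between fun δ hδ => ?_
  filter_upwards [eventually_mul_calF_uniform q₀ hp₀ (isCompact_singleton (x := (l, τ, T)))
    (by rintro x rfl; exact hT) hδ] with ε h
  exact h l τ T rfl

theorem tendsto_mul_calI (q₀ : ℝ) {p₀ : ℝ} (hp₀ : p₀ ≠ 0) {T : ℝ} (hT : 0 < T) (j τ : ℝ) :
    Tendsto (fun ε : ℝ => ((1 / ε ^ 2 : ℝ) : EReal) * calI q₀ p₀ (ε * j) (ε * τ) T)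
      (𝓝[>] 0) (𝓝 ((calG j τ T : ℝ) : EReal)) := by
  refine tendsto_coe_of_eventually_between fun δ hδ => ?_
  filter_upwards [eventually_mul_calI_uniform q₀ hp₀ (isCompact_singleton (x := (j, τ, T)))
    (by rintro x rfl; exact hT) hδ] with ε h
  exact h j τ T rfl

theorem tendsto_scaledCumulant (q₀ : ℝ) {p₀ βL βR : ℝ} (hp₀ : p₀ ≠ 0) (l : ℝ) (hL : 0 < βL)
    (hR : 0 < βR) : Tendsto (fun t : ℝ => scaledCumulant q₀ p₀ βL βR l t) atTop
      (𝓝 (cumulantGF q₀ p₀ l βL βR)) := by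
  by_cases h : βL ≤ l ∨ βR ≤ -l
  · rw [cumulantGF_eq_top q₀ hp₀ hL hR h]
    exact tendsto_scaledCumulant_top q₀ hp₀ hL hR h
  · rw [not_or, not_le, not_le] at h
    obtain ⟨f, -, hlim, -⟩ := exists_growthRate q₀ hp₀ hL hR h.1 (neg_lt.1 h.2)
    rw [cumulantGF, hlim.limsup_eq]
    exact hlim

end ConfinedTracer

end

theorem mainTheorem2 (q₀ p₀ : ℝ) (hq₀ : q₀ ∈ Set.Icc (0 : ℝ) 1) (hp₀ : p₀ ≠ 0) :
    -- the limit that defines the cumulant generating function exists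
    (∀ l βL βR : ℝ, 0 < βL → 0 < βR →
      Tendsto (fun t : ℝ => ConfinedTracer.scaledCumulant q₀ p₀ βL βR l t) atTop
        (𝓝 (ConfinedTracer.cumulantGF q₀ p₀ l βL βR))) ∧
    -- the limits for `τ ≠ 0`
    (∀ τ T : ℝ, 0 < T → τ ≠ 0 →
      (∀ l : ℝ, Tendsto
        (fun ε : ℝ => ((1 / ε ^ 2 : ℝ) : EReal) * ConfinedTracer.calF q₀ p₀ (ε * l) (ε * τ) T)
        (𝓝[>] 0) (𝓝 ((ConfinedTracer.calH l τ T : ℝ) : EReal))) ∧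
      (∀ j : ℝ, Tendsto
        (fun ε : ℝ => ((1 / ε ^ 2 : ℝ) : EReal) * ConfinedTracer.calI q₀ p₀ (ε * j) (ε * τ) T)
        (𝓝[>] 0) (𝓝 ((ConfinedTracer.calG j τ T : ℝ) : EReal)))) ∧
    -- the limits for `τ = 0`
    (∀ T : ℝ, 0 < T →
      (∀ l : ℝ, Tendsto
        (fun ε : ℝ => ((1 / ε ^ 2 : ℝ) : EReal) * ConfinedTracer.calF q₀ p₀ (ε * l) (ε * 0) T)
        (𝓝[>] 0) (𝓝 ((ConfinedTracer.kappa T * l ^ 2 * T ^ 2 : ℝ) : EReal))) ∧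
      (∀ j : ℝ, Tendsto
        (fun ε : ℝ => ((1 / ε ^ 2 : ℝ) : EReal) * ConfinedTracer.calI q₀ p₀ (ε * j) (ε * 0) T)
        (𝓝[>] 0) (𝓝 ((j ^ 2 / (4 * ConfinedTracer.kappa T * T ^ 2) : ℝ) : EReal)))) ∧
    -- uniformity on compact sets of parameters `(l, τ, T)`, respectively `(j, τ, T)`
    (∀ K : Set (ℝ × ℝ × ℝ), IsCompact K → (∀ x ∈ K, 0 < x.2.2) → ∀ δ : ℝ, 0 < δ →
      (∀ᶠ ε : ℝ in 𝓝[>] 0, ∀ l τ T : ℝ, (l, τ, T) ∈ K →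
        ((ConfinedTracer.calH l τ T - δ : ℝ) : EReal) <
            ((1 / ε ^ 2 : ℝ) : EReal) * ConfinedTracer.calF q₀ p₀ (ε * l) (ε * τ) T ∧
          ((1 / ε ^ 2 : ℝ) : EReal) * ConfinedTracer.calF q₀ p₀ (ε * l) (ε * τ) T <
            ((ConfinedTracer.calH l τ T + δ : ℝ) : EReal)) ∧
      (∀ᶠ ε : ℝ in 𝓝[>] 0, ∀ j τ T : ℝ, (j, τ, T) ∈ K →
        ((ConfinedTracer.calG j τ T - δ : ℝ) : EReal) <
            ((1 / ε ^ 2 : ℝ) : EReal) * ConfinedTracer.calI q₀ p₀ (ε * j) (ε * τ) T ∧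
          ((1 / ε ^ 2 : ℝ) : EReal) * ConfinedTracer.calI q₀ p₀ (ε * j) (ε * τ) T <
            ((ConfinedTracer.calG j τ T + δ : ℝ) : EReal))) := by
  refine ⟨fun l βL βR hL hR => ConfinedTracer.tendsto_scaledCumulant q₀ hp₀ l hL hR,
    fun τ T hT _ => ⟨fun l => ConfinedTracer.tendsto_mul_calF q₀ hp₀ hT l τ,
      fun j => ConfinedTracer.tendsto_mul_calI q₀ hp₀ hT j τ⟩,
    fun T hT => ⟨fun l => ?_, fun j => ?_⟩,
    fun K hK hpos δ hδ => ⟨ConfinedTracer.eventually_mul_calF_uniform q₀ hp₀ hK hpos hδ,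
      ConfinedTracer.eventually_mul_calI_uniform q₀ hp₀ hK hpos hδ⟩⟩
  · simpa [ConfinedTracer.calH] using ConfinedTracer.tendsto_mul_calF q₀ hp₀ hT l 0
  · simpa [ConfinedTracer.calG] using ConfinedTracer.tendsto_mul_calI q₀ hp₀ hT j 0
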